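/- Let $P$ be a probability measure on a measurable space $\mathcal X$, and let $(m_n)_n$ be a nondecreasing sequence of natural numbers with $m_n\to\infty$. Let $(k_n)_n$ be measurable positive definite kernels $k_n:\mathcal X\times\mathcal X\to\mathbb R$ (symmetric, with $\sum_{i,j}c_ic_jk_n(x_i,x_j)\ge 0$), with reproducing kernel Hilbert spaces (RKHS) $\mathcal H_n$, whose inner product is $\langle\cdot,\cdot\rangle$. Assume that for every $n$ the mean embedding $\mu_n=\int k_n(x,\cdot)\,dP(x)\in\mathcal H_n$ exists, i.e. every $f\in\mathcal H_n$ is $P$-integrable and $\int f\,dP=\langle f,\mu_n\rangle$, and put $\bar k_n(x,y)=\langle k_n(x,\cdot)-\mu_n,\;k_n(y,\cdot)-\mu_n\rangle$. For every $n$ let $X_1,\dots,X_n,Y_1,\dots,Y_{m}$, $m=m_n$, be i.i.d. with law $P$ (for different $n$ they may live on different probability spaces). Let $n_1=\lfloor n/2\rfloor$, $n_2=n-n_1$, $m_1=\lfloor m/2\rfloor$, $m_2=m-m_1$. With $h_n(x,x',y,y')=k_n(x,x')-k_n(x,y')-k_n(y,x')+k_n(y,y')$ define $$\mathrm{xMMD}^2=\frac1{n_1m_1n_2m_2}\sum_{i=1}^{n_1}\sum_{i'=n_1+1}^{n}\sum_{j=1}^{m_1}\sum_{j'=m_1+1}^{m}h_n(X_i,X_{i'},Y_j,Y_{j'}).$$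 With $g_2=\frac1{n_2}\sum_{i'=n_1+1}^n k_n(X_{i'},\cdot)-\frac1{m_2}\sum_{j'=m_1+1}^m k_n(Y_{j'},\cdot)$, let $U_{X,i}=\langle k_n(X_i,\cdot),g_2\rangle$ for $i\le n_1$ and $U_{Y,j}=\langle k_n(Y_j,\cdot),g_2\rangle$ for $j\le m_1$, with sample means $\bar U_X,\bar U_Y$, and $$\hat\sigma^2=\frac1{n_1}\cdot\frac1{n_1}\sum_{i=1}^{n_1}(U_{X,i}-\bar U_X)^2+\frac1{m_1}\cdot\frac1{m_1}\sum_{j=1}^{m_1}(U_{Y,j}-\bar U_Y)^2 ,\qquad \hat\sigma=\sqrt{\hat\sigma^2}.$$ For independent $Z_1,Z_2\sim P$, assume that $\mathbb E[\bar k_n(Z_1,Z_2)^4]<\infty$ and $\mathbb E[\bar k_n(Z_1,Z_2)^2]>0$ for all large $n$. Let $\lambda_{1,n}\ge\lambda_{2,n}\ge\dots\ge0$ be the eigenvalues, repeated according to multiplicity (and continued by zeros if there are only finitely many), of the integral operator $g\mapsto\int\bar k_n(\cdot,x)g(x)\,dP(x)$ on $L^2(P)$. If $$\lim_{n\to\infty}\frac{\mathbb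 E[\bar k_n(Z_1,Z_2)^4]}{\mathbb E[\bar k_n(Z_1,Z_2)^2]^2}\Bigl(\frac1n+\frac1{m_n}\Bigr)=0\qquad\text{and}\qquad\lim_{n\to\infty}\frac{\lambda_{1,n}^2}{\sum_{l\ge1}\lambda_{l,n}^2}\ \text{ exists},$$ then $\mathrm{xMMD}^2/\hat\sigma$ converges in distribution to $N(0,1)$ as $n\to\infty$ (where $\hat\sigma=0$ or a sample is too small to split, the statistic is set to $0$). -/

import Mathlib

open MeasureTheory ProbabilityTheory Filter Topology
open scoped InnerProductSpace

noncomputable section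

/-- A (real-valued) positive definite kernel on `𝒳`: a symmetric function `k` with
`∑ᵢ ∑ⱼ cᵢ cⱼ k(xᵢ, xⱼ) ≥ 0` for all finite families of points and real coefficients. -/
structure PDKernel (𝒳 : Type*) where
  /-- The kernel function. -/
  toFun : 𝒳 → 𝒳 → ℝ
  posSemidef : (Matrix.of toFun).PosSemidef

namespace PDKernel

variable {𝒳 : Type*}

instance : CoeFun (PDKernel 𝒳) (fun _ => 𝒳 → 𝒳 → ℝ) := ⟨PDKernel.toFun⟩

/-- The kernel as an operator-valued matrix, the form in which Mathlib builds the RKHS. -/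
def opMatrix (k : PDKernel 𝒳) : Matrix 𝒳 𝒳 (ℝ →L[ℝ] ℝ) :=
  Matrix.of fun x y => k x y • ContinuousLinearMap.id ℝ ℝ

lemma opMatrix_posSemidef (k : PDKernel 𝒳) : k.opMatrix.PosSemidef := by
  have hs : ∀ x y, k y x = k x y := fun x y => by
    simpa using k.posSemidef.isHermitian.apply x y
  have key := (RKHS.posSemidef_tfae (K := k.opMatrix)).out 0 2
  refine key.2 ⟨?_, fun v => ?_⟩
  · ext x y
    have hid : ContinuousLinearMap.adjoint (ContinuousLinearMap.id ℝ ℝ) =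
        ContinuousLinearMap.id ℝ ℝ := ContinuousLinearMap.adjoint_id
    simp [opMatrix, ContinuousLinearMap.star_eq_adjoint, hs, hid]
  · have h := k.posSemidef.2 v
    simp only [opMatrix, Matrix.of_apply, FunLike.coe_smul, Pi.smul_apply,
      ContinuousLinearMap.id_apply, smul_eq_mul, RCLike.re_to_real] at h ⊢
    refine le_of_le_of_eq h ?_
    refine Finsupp.sum_congr fun x _ => Finsupp.sum_congr fun y _ => ?_
    simp [hs x y]
    ring

instance (k : PDKernel 𝒳) : Fact k.opMatrix.PosSemidef := ⟨k.opMatrix_posSemidef⟩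

/-- The reproducing kernel Hilbert space of `k`. -/
abbrev Space (k : PDKernel 𝒳) : Type _ := RKHS.OfKernel k.opMatrix

/-- The function `k(x, ·)` as an element of the RKHS of `k`. -/
def feature (k : PDKernel 𝒳) (x : 𝒳) : k.Space := RKHS.kerFun k.Space x 1

lemma feature_apply (k : PDKernel 𝒳) (x y : 𝒳) : k.feature x y = k x y := by
  have hs : k y x = k x y := by simpa using k.posSemidef.isHermitian.apply x y
  rw [feature, RKHS.kerFun_apply, RKHS.OfKernel.kernel_ofKernel]
  simp [opMatrix, hs]

/-- The reproducing property. -/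
lemma inner_feature (k : PDKernel 𝒳) (f : k.Space) (x : 𝒳) : ⟪f, k.feature x⟫_ℝ = f x := by
  simp [feature]

/-- `μ` is the kernel mean embedding `∫ k(x, ·) dP(x)` of `P` into the RKHS of `k`
(the integral being a weak one): every `f` in the RKHS is `P`-integrable and `∫ f dP = ⟪f, μ⟫`. -/
def IsMeanEmbedding [MeasurableSpace 𝒳] (k : PDKernel 𝒳) (P : Measure 𝒳) (μ : k.Space) : Prop :=
  ∀ f : k.Space, Integrable (fun x => f x) P ∧ ∫ x, f x ∂P = ⟪f, μ⟫_ℝ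

/-- The centered kernel `k̄(x, y) = ⟪k(x, ·) - μ, k(y, ·) - μ⟫`. -/
def centered (k : PDKernel 𝒳) (μ : k.Space) (x y : 𝒳) : ℝ :=
  ⟪k.feature x - μ, k.feature y - μ⟫_ℝ

/-- `h(x, x', y, y') = k(x, x') - k(x, y') - k(y, x') + k(y, y')`. -/
def h (k : PDKernel 𝒳) (x x' y y' : 𝒳) : ℝ := k x x' - k x y' - k y x' + k y y'

/-- The empirical kernel embedding `N⁻¹ ∑ᵢ k(xᵢ, ·)` of a sample of size `N`. -/
def empiricalEmbedding (k : PDKernel 𝒳) {N : ℕ} (x : Fin N → 𝒳) : k.Space :=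
  (N : ℝ)⁻¹ • ∑ i, k.feature (x i)

/-- The cross-MMD statistic of the split samples `x₁, x₂` and `y₁, y₂`. -/
def crossMMDSq (k : PDKernel 𝒳) {n₁ n₂ m₁ m₂ : ℕ} (x₁ : Fin n₁ → 𝒳) (x₂ : Fin n₂ → 𝒳)
    (y₁ : Fin m₁ → 𝒳) (y₂ : Fin m₂ → 𝒳) : ℝ :=
  1 / ((n₁ : ℝ) * m₁ * n₂ * m₂) *
    ∑ i, ∑ i', ∑ j, ∑ j', k.h (x₁ i) (x₂ i') (y₁ j) (y₂ j')

end PDKernel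

/-- The mean of a finite sample of reals. -/
def sampleMean {N : ℕ} (u : Fin N → ℝ) : ℝ := 1 / (N : ℝ) * ∑ i, u i

/-- The empirical variance `N⁻¹ ∑ᵢ (uᵢ - ū)²`. -/
def sampleVariance {N : ℕ} (u : Fin N → ℝ) : ℝ :=
  1 / (N : ℝ) * ∑ i, (u i - sampleMean u) ^ 2

/-- The first part `(x₁, …, x_{⌊n/2⌋})` of the balanced split. -/
def firstHalf {𝒳 : Type*} {n : ℕ} (x : Fin n → 𝒳) : Fin (n / 2) → 𝒳 :=
  fun i => x ⟨i, by omega⟩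

/-- The second part `(x_{⌊n/2⌋+1}, …, x_n)` of the balanced split. -/
def secondHalf {𝒳 : Type*} {n : ℕ} (x : Fin n → 𝒳) : Fin (n - n / 2) → 𝒳 :=
  fun i => x ⟨n / 2 + i, by omega⟩

namespace PDKernel

variable {𝒳 : Type*}

/-- The empirical variance `σ̂² = σ̂_X² / n₁ + σ̂_Y² / m₁`, where `σ̂_X²` and `σ̂_Y²` are the
empirical variances of `U_{X,i} = ⟪k(x₁ᵢ, ·), μ̂₂ - ν̂₂⟫` and `U_{Y,j} = ⟪k(y₁ⱼ, ·), μ̂₂ - ν̂₂⟫`. -/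
def crossVariance (k : PDKernel 𝒳) {n₁ n₂ m₁ m₂ : ℕ} (x₁ : Fin n₁ → 𝒳) (x₂ : Fin n₂ → 𝒳)
    (y₁ : Fin m₁ → 𝒳) (y₂ : Fin m₂ → 𝒳) : ℝ :=
  let g₂ : k.Space := k.empiricalEmbedding x₂ - k.empiricalEmbedding y₂
  1 / (n₁ : ℝ) * sampleVariance (fun i => ⟪k.feature (x₁ i), g₂⟫_ℝ) +
    1 / (m₁ : ℝ) * sampleVariance (fun j => ⟪k.feature (y₁ j), g₂⟫_ℝ)

/-- The studentized cross-MMD statistic `xMMD² / σ̂` of the samples `x` and `y`, with the balanced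
splits `n₁ = ⌊n/2⌋` and `m₁ = ⌊m/2⌋`. -/
def studentizedCrossMMD (k : PDKernel 𝒳) {n m : ℕ} (x : Fin n → 𝒳) (y : Fin m → 𝒳) : ℝ :=
  k.crossMMDSq (firstHalf x) (secondHalf x) (firstHalf y) (secondHalf y) /
    √(k.crossVariance (firstHalf x) (secondHalf x) (firstHalf y) (secondHalf y))

end PDKernel

/-- `φ ∈ L²(P)` satisfies the eigenvalue equation, with eigenvalue `c`, of the integral operator
`g ↦ ∫ κ(·, x) g(x) dP(x)` on `L²(P)`. -/
def IsKernelEigenfunction {𝒳 : Type*} [MeasurableSpace 𝒳] (κ : 𝒳 → 𝒳 → ℝ) (P : Measure 𝒳)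
    (c : ℝ) (φ : Lp ℝ 2 P) : Prop :=
  ∀ᵐ y ∂P, ∫ x, κ y x * φ x ∂P = c * φ y

/-- The eigenvalues of the integral operator `g ↦ ∫ κ(·, x) g(x) dP(x)` on `L²(P)`, in decreasing
order and repeated according to multiplicity; the index starts at `0`, so that
`kernelEigenvalue κ P 0` is the largest one. It is the largest `t` for which there are `l + 1`
orthonormal eigenfunctions whose eigenvalues are all at least `t`. The operator being compact,
self-adjoint and nonnegative for the `κ` that are used here, the supremum is attained when it is
positive, and it is `0` when there are at most `l` positive eigenvalues. -/
def kernelEigenvalue {𝒳 : Type*} [MeasurableSpace 𝒳] (κ : 𝒳 → 𝒳 → ℝ) (P : Measure 𝒳)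
    (l : ℕ) : ℝ :=
  sSup {t : ℝ | ∃ (c : Fin (l + 1) → ℝ) (φ : Fin (l + 1) → Lp ℝ 2 P), Orthonormal ℝ φ ∧
    ∀ i, IsKernelEigenfunction κ P (c i) (φ i) ∧ t ≤ c i}

end

/-!
The cross statistic is, given the second halves of the two samples, a studentized difference of
means of i.i.d. variables `V(Xᵢ)` and `V(Yⱼ)`. Here `V = ∑ aᵢ κ(wᵢ, ·)` is the witness function built
from the second halves `w` with the weights `1 / n₂` and `-1 / m₂`, and `κ` is the centred kernel:
as the weights add up to `0` and a studentized difference does not see additive constants, the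
uncentred kernel may be replaced by the centred one (`studentizedCrossMMD_eq`). Besides measurability,
symmetry and moments, all that is used of `κ` is that `∫ κ(x, y) dP(y) = 0` for every `x`.

Write `q` and `Q` for the second and the fourth moment of `κ` under `P ⊗ P`, `τ = ∫ V² dP`,
`F = ∫ V⁴ dP`, and `s = 1 / n₂ + 1 / m₂`. A quantitative Lyapunov theorem, stated for characteristic
functions (`norm_charFun_studentizedDifference_sub_le`), shows that the conditional law of the
statistic is close to `N(0, 1)` when `(1 / n₁ + 1 / m₁) F / τ²` is small. The numerator is controlled
by its mean, `E F ≤ 3 s² Q` (`integral_kernelSum_pow_four_le`). For the denominator one has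
`E τ = s q`, and the point is that `τ / (s q)` stays away from `0` in probability
(`exists_measureReal_norm_sq_le`). With `Φ(x) = κ(x, ·) ∈ L²(P)` one has `τ = ‖∑ aᵢ Φ(wᵢ)‖²`, and
there are two cases for the ratio `e / q²`, where `e = ∫∫ ⟪Φ(x), Φ(y)⟫² dP dP`; in terms of the
eigenvalues `λₗ` of the integral operator, `q = ∑ λₗ²` and `e = ∑ λₗ⁴`.

* If `e / q²` is small, then `τ` concentrates around its mean by Chebyshev's inequality
  (`IsCenteredFeature.measureReal_norm_sq_le_half`).
* If `e / q²` is bounded below, then so is the share of the variance that is carried by some single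
  direction `Φ(z₀) / ‖Φ(z₀)‖` (`IsCenteredFeature.exists_direction`). The projection of `∑ aᵢ Φ(wᵢ)`
  to this direction is a weighted i.i.d. sum, close to a Gaussian variable by the Lyapunov theorem
  again, and so it does not concentrate at `0` (`measureReal_abs_le_le_of_charFun`).

All bounds depend on the kernel and on the sample sizes only through `Q / q²` times the sum of the
inverse sample sizes, so the characteristic functions converge pointwise, and the theorem follows
from Lévy's convergence theorem.
-/

/-! ### Characteristic functions of weighted i.i.d. sums -/

namespace CrossMMD

variable {𝒳 : Type*} [MeasurableSpace 𝒳] {P : Measure 𝒳} {ι : Type*}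

lemma norm_prod_sub_prod_le_sum (s : Finset ι) (a b : ι → ℂ)
    (ha : ∀ i, ‖a i‖ ≤ 1) (hb : ∀ i, ‖b i‖ ≤ 1) :
    ‖∏ i ∈ s, a i - ∏ i ∈ s, b i‖ ≤ ∑ i ∈ s, ‖a i - b i‖ := by
  classical
  induction s using Finset.induction_on with
  | empty => simp
  | insert j s hj ih =>
    rw [Finset.prod_insert hj, Finset.prod_insert hj, Finset.sum_insert hj]
    have hsplit : a j * ∏ i ∈ s, a i - b j * ∏ i ∈ s, b i =
        (a j - b j) * ∏ i ∈ s, a i + b j * (∏ i ∈ s, a i - ∏ i ∈ s, b i) := by ring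
    have hA : ‖∏ i ∈ s, a i‖ ≤ 1 := by
      rw [norm_prod]
      exact Finset.prod_le_one (fun i _ => norm_nonneg _) fun i _ => ha i
    rw [hsplit]
    refine (norm_add_le _ _).trans (add_le_add ?_ ?_)
    · rw [norm_mul]
      exact mul_le_of_le_one_right (norm_nonneg _) hA
    · rw [norm_mul]
      exact (mul_le_of_le_one_left (norm_nonneg _) (hb j)).trans ih

lemma norm_cexp_mul_I_sub_taylor_le (x : ℝ) :
    ‖Complex.exp (x * Complex.I) - (1 + x * Complex.I - x ^ 2 / 2)‖ ≤ 4 * |x| ^ 3 := by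
  rcases le_or_gt |x| 1 with hx | hx
  · have h := Complex.exp_bound (x := x * Complex.I) (by simpa using hx) (n := 3) (by norm_num)
    have hsum : ∑ m ∈ Finset.range 3, (x * Complex.I : ℂ) ^ m / (m.factorial : ℂ) =
        1 + x * Complex.I - x ^ 2 / 2 := by
      simp [Finset.sum_range_succ, Nat.factorial, mul_pow, Complex.I_sq]
      ring
    rw [hsum] at h
    refine h.trans ?_
    have h3 : 0 ≤ |x| ^ 3 := by positivity
    simp only [norm_mul, Complex.norm_real, Complex.norm_I, mul_one, Real.norm_eq_abs]
    norm_num [Nat.factorial]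
    linarith
  · have h1 : ‖Complex.exp (x * Complex.I)‖ = 1 := Complex.norm_exp_ofReal_mul_I x
    have h2 : ‖(1 + x * Complex.I - x ^ 2 / 2 : ℂ)‖ ≤ 1 + |x| + |x| ^ 2 / 2 := by
      refine (norm_sub_le _ _).trans (add_le_add ((norm_add_le _ _).trans ?_) ?_) <;> simp
    refine (norm_sub_le _ _).trans ?_
    rw [h1]
    nlinarith [mul_pos (sub_pos.2 hx) (sub_pos.2 hx), pow_pos (zero_lt_one.trans hx) 2,
      mul_pos (sub_pos.2 hx) (pow_pos (zero_lt_one.trans hx) 2)]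

lemma abs_exp_neg_sub_le {u : ℝ} (hu : 0 ≤ u) : |Real.exp (-u) - (1 - u)| ≤ u ^ 2 := by
  rcases le_or_gt u 1 with h | h
  · have := Real.abs_exp_sub_one_sub_id_le (x := -u) (by rwa [abs_neg, abs_of_nonneg hu])
    rwa [neg_sq, show Real.exp (-u) - 1 - -u = Real.exp (-u) - (1 - u) by ring] at this
  · have h1 : Real.exp (-u) ≤ 1 := Real.exp_le_one_iff.2 (by linarith)
    have h2 := Real.exp_pos (-u)
    rw [abs_le]
    constructor <;> nlinarith

lemma integrable_pow_of_memLp_four [IsFiniteMeasure P] {f : 𝒳 → ℝ} (hf : MemLp f 4 P) {p : ℕ}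
    (hp : p ≤ 4) : Integrable (fun x => f x ^ p) P := by
  have h : MemLp f p P := hf.mono_exponent (by exact_mod_cast hp)
  rcases Nat.eq_zero_or_pos p with rfl | h0
  · simp
  · refine (h.integrable_norm_pow h0.ne').mono (hf.1.pow p) (ae_of_all _ fun x => by simp)

lemma sq_integral_sq_le [IsProbabilityMeasure P] {f : 𝒳 → ℝ} (hf : MemLp f 4 P) :
    (∫ x, f x ^ 2 ∂P) ^ 2 ≤ ∫ x, f x ^ 4 ∂P := by
  have h2 := integrable_pow_of_memLp_four hf (p := 2) (by norm_num)
  have h4 := integrable_pow_of_memLp_four hf (p := 4) (by norm_num)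
  set c := ∫ x, f x ^ 2 ∂P
  have h : 0 ≤ ∫ x, (f x ^ 2 - c) ^ 2 ∂P := integral_nonneg fun x => sq_nonneg _
  have he : ∫ x, (f x ^ 2 - c) ^ 2 ∂P = ∫ x, f x ^ 4 ∂P - 2 * c * c + c ^ 2 := by
    have : ∀ x, (f x ^ 2 - c) ^ 2 = f x ^ 4 - 2 * c * f x ^ 2 + c ^ 2 := fun x => by ring
    have h2' : Integrable (fun x => 2 * c * f x ^ 2) P := h2.const_mul _
    have h24 : Integrable (fun x => f x ^ 4 - 2 * c * f x ^ 2) P := h4.sub h2'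
    simp_rw [this]
    rw [integral_add h24 (integrable_const _), integral_sub h4 h2', integral_const_mul]
    simp [c]
  nlinarith

/-- Second-order expansion of the characteristic function of a centred variable. The cubic
remainder is split into a second and a fourth moment with the help of a free parameter `θ`. -/
lemma norm_integral_cexp_sub_le [IsProbabilityMeasure P] {f : 𝒳 → ℝ} (hf : MemLp f 4 P)
    (h0 : ∫ x, f x ∂P = 0) (t c : ℝ) {θ : ℝ} (hθ : 0 < θ) :
    ‖∫ x, Complex.exp ((t * (c * f x) : ℝ) * Complex.I) ∂P -
        Complex.exp ((-(t ^ 2 * (c ^ 2 * ∫ x, f x ^ 2 ∂P) / 2) : ℝ))‖ ≤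
      4 * |t| ^ 3 * (θ * (c ^ 2 * ∫ x, f x ^ 2 ∂P) + θ⁻¹ * (c ^ 4 * ∫ x, f x ^ 4 ∂P)) +
        t ^ 4 * (c ^ 4 * ∫ x, f x ^ 4 ∂P) := by
  have hf1 : Integrable f P := by
    simpa using integrable_pow_of_memLp_four hf (p := 1) (by norm_num)
  have hf2 := integrable_pow_of_memLp_four hf (p := 2) (by norm_num)
  have hf4 := integrable_pow_of_memLp_four hf (p := 4) (by norm_num)
  set σ := ∫ x, f x ^ 2 ∂P with hσ
  set M := ∫ x, f x ^ 4 ∂P with hM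
  have hσ0 : 0 ≤ σ := integral_nonneg fun x => sq_nonneg _
  have hσM : σ ^ 2 ≤ M := sq_integral_sq_le hf
  have hT : ∫ x, (1 + (t * (c * f x) : ℝ) * Complex.I - ((t * (c * f x) : ℝ) : ℂ) ^ 2 / 2) ∂P =
      ((1 - t ^ 2 * (c ^ 2 * σ) / 2 : ℝ) : ℂ) := by
    have h1 : Integrable (fun x => ((t * (c * f x) : ℝ) : ℂ)) P :=
      ((hf1.const_mul c).const_mul t).ofReal
    have h2r : Integrable (fun x => (t * (c * f x)) ^ 2 / 2) P :=
      (hf2.const_mul (t ^ 2 * c ^ 2 / 2)).congr (ae_of_all _ fun x => by ring)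
    have h2 : Integrable (fun x => (((t * (c * f x)) ^ 2 / 2 : ℝ) : ℂ)) P := h2r.ofReal
    have h1I : Integrable (fun x => ((t * (c * f x) : ℝ) : ℂ) * Complex.I) P := h1.mul_const _
    have h11 : Integrable (fun x => 1 + ((t * (c * f x) : ℝ) : ℂ) * Complex.I) P :=
      (integrable_const _).add h1I
    have h2' : ∀ x, ((t * (c * f x) : ℝ) : ℂ) ^ 2 / 2 = (((t * (c * f x)) ^ 2 / 2 : ℝ) : ℂ) :=
      fun x => by push_cast; ring
    simp_rw [h2']
    rw [integral_sub h11 h2, integral_add (integrable_const _) h1I, integral_mul_const,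
      integral_complex_ofReal, integral_complex_ofReal, integral_const_mul, integral_const_mul, h0]
    have h3 : ∫ x, (t * (c * f x)) ^ 2 / 2 ∂P = t ^ 2 * (c ^ 2 * σ) / 2 := by
      rw [hσ, ← integral_const_mul, ← integral_const_mul, ← integral_div]
      congr with x
      ring
    rw [h3]
    simp
  have hmeas : AEStronglyMeasurable
      (fun x => Complex.exp ((t * (c * f x) : ℝ) * Complex.I)) P := by
    have := hf.1
    have h : Continuous fun y : ℝ => Complex.exp ((t * (c * y) : ℝ) * Complex.I) := by fun_prop
    exact h.comp_aestronglyMeasurable this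
  have hint : Integrable (fun x => Complex.exp ((t * (c * f x) : ℝ) * Complex.I)) P :=
    Integrable.of_bound hmeas 1 (ae_of_all _ fun x => (Complex.norm_exp_ofReal_mul_I _).le)
  have hintT : Integrable (fun x => (1 + (t * (c * f x) : ℝ) * Complex.I -
      ((t * (c * f x) : ℝ) : ℂ) ^ 2 / 2)) P := by
    refine ((integrable_const _).add
      (((hf1.const_mul c).const_mul t).ofReal.mul_const _)).sub ?_
    have : Integrable (fun x => (((t ^ 2 * c ^ 2 / 2) * f x ^ 2 : ℝ) : ℂ)) P :=
      (hf2.const_mul _).ofReal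
    refine this.congr (ae_of_all _ fun x => ?_)
    simp only
    push_cast
    ring
  have hA : ‖∫ x, Complex.exp ((t * (c * f x) : ℝ) * Complex.I) ∂P -
      ((1 - t ^ 2 * (c ^ 2 * σ) / 2 : ℝ) : ℂ)‖ ≤
      4 * |t| ^ 3 * (θ * (c ^ 2 * σ) + θ⁻¹ * (c ^ 4 * M)) := by
    rw [← hT, ← integral_sub hint hintT]
    have hR : ∫ x, 4 * |t| ^ 3 * (θ * (c ^ 2 * f x ^ 2) + θ⁻¹ * (c ^ 4 * f x ^ 4)) ∂P =
        4 * |t| ^ 3 * (θ * (c ^ 2 * σ) + θ⁻¹ * (c ^ 4 * M)) := by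
      rw [integral_const_mul, integral_add ((hf2.const_mul _).const_mul _)
        ((hf4.const_mul _).const_mul _)]
      simp only [integral_const_mul, hσ, hM]
    rw [← hR]
    refine norm_integral_le_of_norm_le ((((hf2.const_mul _).const_mul _).add
        ((hf4.const_mul _).const_mul _)).const_mul _) (ae_of_all _ fun x => ?_)
    refine (norm_cexp_mul_I_sub_taylor_le _).trans ?_
    rw [abs_mul, mul_pow, mul_assoc]
    gcongr
    set y := c * f x with hy
    have e2 : c ^ 2 * f x ^ 2 = |y| ^ 2 := by rw [sq_abs, hy]; ring
    have e4 : c ^ 4 * f x ^ 4 = |y| ^ 4 := by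
      rw [hy, ← abs_pow, abs_of_nonneg (by positivity)]; ring
    rw [e2, e4]
    -- `|y|³ ≤ θ |y|² + θ⁻¹ |y|⁴`, by completing the square
    have h5 : θ * |y| ^ 2 + θ⁻¹ * |y| ^ 4 - |y| ^ 3 =
        θ⁻¹ * |y| ^ 2 * ((|y| - θ / 2) ^ 2 + 3 / 4 * θ ^ 2) := by
      field_simp
      ring
    have h6 : 0 ≤ θ⁻¹ * |y| ^ 2 * ((|y| - θ / 2) ^ 2 + 3 / 4 * θ ^ 2) := by positivity
    linarith
  have hB : ‖((1 - t ^ 2 * (c ^ 2 * σ) / 2 : ℝ) : ℂ) -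
      Complex.exp ((-(t ^ 2 * (c ^ 2 * σ) / 2) : ℝ))‖ ≤ t ^ 4 * (c ^ 4 * M) := by
    rw [← Complex.ofReal_exp, ← Complex.ofReal_sub, Complex.norm_real, Real.norm_eq_abs,
      abs_sub_comm]
    refine (abs_exp_neg_sub_le (by positivity)).trans ?_
    have : (t ^ 2 * (c ^ 2 * σ) / 2) ^ 2 = t ^ 4 * (c ^ 4 * σ ^ 2) / 4 := by ring
    rw [this]
    have h5 : t ^ 4 * (c ^ 4 * σ ^ 2) ≤ t ^ 4 * (c ^ 4 * M) := by gcongr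
    have h6 : 0 ≤ t ^ 4 * (c ^ 4 * σ ^ 2) := by positivity
    linarith
  calc _ ≤ _ := norm_sub_le_norm_sub_add_norm_sub _ ((1 - t ^ 2 * (c ^ 2 * σ) / 2 : ℝ) : ℂ) _
    _ ≤ _ := add_le_add hA hB

variable [Fintype ι]

/-- Quantitative Lyapunov central limit theorem for a weighted i.i.d. sum of variance `1`, in terms
of characteristic functions. -/
lemma norm_charFun_weighted_sum_sub_le [IsProbabilityMeasure P] {f : 𝒳 → ℝ} (hf : MemLp f 4 P)
    (h0 : ∫ x, f x ∂P = 0) (c : ι → ℝ) (hvar : (∑ i, c i ^ 2) * ∫ x, f x ^ 2 ∂P = 1) (t : ℝ)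
    {θ : ℝ} (hθ : 0 < θ) :
    ‖∫ w : ι → 𝒳, Complex.exp ((t * ∑ i, c i * f (w i) : ℝ) * Complex.I)
        ∂(Measure.pi fun _ => P) - Complex.exp ((-(t ^ 2 / 2) : ℝ))‖ ≤
      4 * |t| ^ 3 * (θ + θ⁻¹ * ((∑ i, c i ^ 4) * ∫ x, f x ^ 4 ∂P)) +
        t ^ 4 * ((∑ i, c i ^ 4) * ∫ x, f x ^ 4 ∂P) := by
  have h1 : ∀ w : ι → 𝒳, Complex.exp ((t * ∑ i, c i * f (w i) : ℝ) * Complex.I) =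
      ∏ i, Complex.exp ((t * (c i * f (w i)) : ℝ) * Complex.I) := fun w => by
    rw [← Complex.exp_sum, Finset.mul_sum]
    push_cast
    rw [Finset.sum_mul]
  have h2 : Complex.exp ((-(t ^ 2 / 2) : ℝ)) =
      ∏ i : ι, Complex.exp ((-(t ^ 2 * (c i ^ 2 * ∫ x, f x ^ 2 ∂P) / 2) : ℝ)) := by
    rw [← Complex.exp_sum, ← Complex.ofReal_sum]
    congr 2
    rw [Finset.sum_neg_distrib, ← Finset.sum_div, ← Finset.mul_sum, ← Finset.sum_mul, hvar, mul_one]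
  simp_rw [h1]
  rw [integral_fintype_prod_eq_prod
    (fun i x => Complex.exp ((t * (c i * f x) : ℝ) * Complex.I)), h2]
  refine (norm_prod_sub_prod_le_sum _ _ _ (fun i => ?_) fun i => ?_).trans ?_
  · refine (norm_integral_le_of_norm_le_const (C := 1) (ae_of_all _ fun x => ?_)).trans (by simp)
    exact (Complex.norm_exp_ofReal_mul_I _).le
  · rw [← Complex.ofReal_exp, Complex.norm_real, Real.norm_eq_abs, Real.abs_exp,
      Real.exp_le_one_iff, neg_nonpos]
    have : 0 ≤ ∫ x, f x ^ 2 ∂P := integral_nonneg fun x => sq_nonneg _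
    positivity
  · refine (Finset.sum_le_sum fun i _ => norm_integral_cexp_sub_le hf h0 t (c i) hθ).trans
      (le_of_eq ?_)
    rw [Finset.sum_add_distrib, ← Finset.mul_sum, Finset.sum_add_distrib, ← Finset.mul_sum,
      ← Finset.mul_sum, ← Finset.mul_sum, ← Finset.sum_mul, ← Finset.sum_mul, hvar, mul_one]

end CrossMMD

/-! ### Moments and anti-concentration of weighted i.i.d. sums -/

namespace CrossMMD

variable {𝒳 : Type*} [MeasurableSpace 𝒳] {P : Measure 𝒳} {ι : Type*}

section
variable [Fintype ι]

/-- The bound of `norm_charFun_weighted_sum_sub_le` when the fourth moments add up to at most `d ^ 2`;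
the parameter `θ` is then best taken to be `d`. -/
lemma norm_charFun_weighted_sum_sub_le' [IsProbabilityMeasure P] {f : 𝒳 → ℝ} (hf : MemLp f 4 P)
    (h0 : ∫ x, f x ∂P = 0) (c : ι → ℝ) (hvar : (∑ i, c i ^ 2) * ∫ x, f x ^ 2 ∂P = 1) {d : ℝ}
    (hd0 : 0 < d) (hd1 : d ≤ 1) (hL : (∑ i, c i ^ 4) * ∫ x, f x ^ 4 ∂P ≤ d ^ 2) (t : ℝ) :
    ‖∫ w : ι → 𝒳, Complex.exp ((t * ∑ i, c i * f (w i) : ℝ) * Complex.I)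
        ∂(Measure.pi fun _ => P) - Complex.exp ((-(t ^ 2 / 2) : ℝ))‖ ≤
      (8 * |t| ^ 3 + t ^ 4) * d := by
  refine (norm_charFun_weighted_sum_sub_le hf h0 c hvar t hd0).trans ?_
  have h1 : d⁻¹ * ((∑ i, c i ^ 4) * ∫ x, f x ^ 4 ∂P) ≤ d :=
    (mul_le_mul_of_nonneg_left hL (by positivity)).trans (le_of_eq (by field_simp))
  have h2 : (∑ i, c i ^ 4) * ∫ x, f x ^ 4 ∂P ≤ d := hL.trans (by nlinarith)
  calc _ ≤ 4 * |t| ^ 3 * (d + d) + t ^ 4 * d := by gcongr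
    _ = _ := by ring

/-- The first, second and fourth moments of a weighted i.i.d. sum of centred variables. -/
lemma moments_weighted_sum [IsProbabilityMeasure P] {f : 𝒳 → ℝ} (hf : MemLp f 4 P)
    (h0 : ∫ x, f x ∂P = 0) (c : ι → ℝ) (s : Finset ι) :
    MemLp (fun w : ι → 𝒳 => ∑ i ∈ s, c i * f (w i)) 4 (Measure.pi fun _ => P) ∧
    ∫ w : ι → 𝒳, ∑ i ∈ s, c i * f (w i) ∂(Measure.pi fun _ => P) = 0 ∧
    ∫ w : ι → 𝒳, (∑ i ∈ s, c i * f (w i)) ^ 2 ∂(Measure.pi fun _ => P) =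
      (∑ i ∈ s, c i ^ 2) * ∫ x, f x ^ 2 ∂P ∧
    ∫ w : ι → 𝒳, (∑ i ∈ s, c i * f (w i)) ^ 4 ∂(Measure.pi fun _ => P) ≤
      3 * (∑ i ∈ s, c i ^ 2) ^ 2 * ∫ x, f x ^ 4 ∂P := by
  classical
  induction s using Finset.induction_on with
  | empty => simp
  | insert j s hj ih =>
    obtain ⟨hS, hS1, hS2, hS4⟩ := ih
    set μ : Measure (ι → 𝒳) := Measure.pi fun _ => P
    set S : (ι → 𝒳) → ℝ := fun w => ∑ i ∈ s, c i * f (w i) with hSdef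
    set X : (ι → 𝒳) → ℝ := fun w => c j * f (w j) with hXdef
    have hev : MeasurePreserving (fun w : ι → 𝒳 => w j) μ P := measurePreserving_eval _ j
    have hX : MemLp X 4 μ := (hf.comp_measurePreserving hev).const_mul (c j)
    have hXp : ∀ p : ℕ, ∫ w, X w ^ p ∂μ = c j ^ p * ∫ x, f x ^ p ∂P := fun p => by
      have : ∫ w : ι → 𝒳, f (w j) ^ p ∂μ = ∫ x, f x ^ p ∂P :=
        integral_comp_eval (μ := fun _ : ι => P) (i := j) (f := fun x => f x ^ p) (hf.1.pow p)
      simp_rw [hXdef, mul_pow]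
      rw [integral_const_mul, this]
    have hX1 : ∫ w, X w ∂μ = 0 := by simpa [h0] using hXp 1
    have hind : IndepFun S X μ := by
      have h := (iIndepFun_pi (μ := fun _ : ι => P) (X := fun i x => c i * f x)
        fun i => (hf.1.aemeasurable.const_mul _)).indepFun_finsetSum_of_notMem₀
          (fun i => (hf.1.aemeasurable.const_mul (c i)).comp_quasiMeasurePreserving
            (Measure.quasiMeasurePreserving_eval _ i)) hj
      have he : S = ∑ i ∈ s, fun w : ι → 𝒳 => c i * f (w i) := by
        ext w
        simp [hSdef]
      rw [he]
      exact h
    have hmix : ∀ p q : ℕ, ∫ w, S w ^ p * X w ^ q ∂μ =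
        (∫ w, S w ^ p ∂μ) * ∫ w, X w ^ q ∂μ := fun p q =>
      (hind.comp (φ := fun y => y ^ p) (ψ := fun y => y ^ q)
        (by fun_prop) (by fun_prop)).integral_fun_mul_eq_mul_integral (hS.1.pow p) (hX.1.pow q)
    have hmixI : ∀ p q : ℕ, p ≤ 4 → q ≤ 4 → Integrable (fun w => S w ^ p * X w ^ q) μ :=
      fun p q hp hq => (hind.comp (φ := fun y => y ^ p) (ψ := fun y => y ^ q)
        (by fun_prop) (by fun_prop)).integrable_mul (integrable_pow_of_memLp_four hS hp)
          (integrable_pow_of_memLp_four hX hq)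
    have hSX : (fun w : ι → 𝒳 => ∑ i ∈ insert j s, c i * f (w i)) = fun w => S w + X w := by
      ext w
      rw [Finset.sum_insert hj, add_comm]
    have i20 := hmixI 2 0 (by norm_num) (by norm_num)
    have i02 := hmixI 0 2 (by norm_num) (by norm_num)
    have i11 := hmixI 1 1 (by norm_num) (by norm_num)
    have i40 := hmixI 4 0 (by norm_num) (by norm_num)
    have i31 := hmixI 3 1 (by norm_num) (by norm_num)
    have i22 := hmixI 2 2 (by norm_num) (by norm_num)
    have i13 := hmixI 1 3 (by norm_num) (by norm_num)
    have i04 := hmixI 0 4 (by norm_num) (by norm_num)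
    have hS1' : ∫ w, S w ^ 1 ∂μ = 0 := by simpa using hS1
    have hX1' : ∫ w, X w ^ 1 ∂μ = 0 := by simpa using hX1
    have hsq : ∀ w, (∑ i ∈ insert j s, c i * f (w i)) = S w + X w := fun w => congrFun hSX w
    refine ⟨?_, ?_, ?_, ?_⟩
    · rw [hSX]
      exact hS.add hX
    · simp_rw [hsq]
      rw [integral_add (hS.integrable (by norm_num)) (hX.integrable (by norm_num)), hX1, hS1,
        add_zero]
    · have e : ∀ w, (S w + X w) ^ 2 =
          S w ^ 2 * X w ^ 0 + 2 * (S w ^ 1 * X w ^ 1) + S w ^ 0 * X w ^ 2 := fun w => by ring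
      simp_rw [hsq, e]
      have i11' : Integrable (fun w => 2 * (S w ^ 1 * X w ^ 1)) μ := i11.const_mul 2
      have ia : Integrable (fun w => S w ^ 2 * X w ^ 0 + 2 * (S w ^ 1 * X w ^ 1)) μ := i20.add i11'
      rw [integral_add ia i02, integral_add i20 i11', integral_const_mul, hmix, hmix, hmix, hX1',
        hS2, hXp 2, Finset.sum_insert hj]
      simp
      ring
    · have e : ∀ w, (S w + X w) ^ 4 = S w ^ 4 * X w ^ 0 + 4 * (S w ^ 3 * X w ^ 1) +
          6 * (S w ^ 2 * X w ^ 2) + 4 * (S w ^ 1 * X w ^ 3) + S w ^ 0 * X w ^ 4 := fun w => by ring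
      simp_rw [hsq, e]
      have i31' : Integrable (fun w => 4 * (S w ^ 3 * X w ^ 1)) μ := i31.const_mul 4
      have i22' : Integrable (fun w => 6 * (S w ^ 2 * X w ^ 2)) μ := i22.const_mul 6
      have i13' : Integrable (fun w => 4 * (S w ^ 1 * X w ^ 3)) μ := i13.const_mul 4
      have ia : Integrable (fun w => S w ^ 4 * X w ^ 0 + 4 * (S w ^ 3 * X w ^ 1)) μ := i40.add i31'
      have ib : Integrable (fun w => S w ^ 4 * X w ^ 0 + 4 * (S w ^ 3 * X w ^ 1) +
          6 * (S w ^ 2 * X w ^ 2)) μ := ia.add i22'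
      have ic : Integrable (fun w => S w ^ 4 * X w ^ 0 + 4 * (S w ^ 3 * X w ^ 1) +
          6 * (S w ^ 2 * X w ^ 2) + 4 * (S w ^ 1 * X w ^ 3)) μ := ib.add i13'
      rw [integral_add ic i04, integral_add ib i13', integral_add ia i22', integral_add i40 i31',
        integral_const_mul, integral_const_mul, integral_const_mul, hmix, hmix, hmix, hmix, hmix,
        hX1', hS1', hS2, hXp 2, hXp 4, Finset.sum_insert hj]
      simp only [pow_zero, integral_const, probReal_univ, smul_eq_mul, mul_one, mul_zero, add_zero,
        zero_mul, one_mul]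
      have hjen := sq_integral_sq_le hf
      set σ := ∫ x, f x ^ 2 ∂P
      set M := ∫ x, f x ^ 4 ∂P
      set A := ∑ i ∈ s, c i ^ 2
      have hA : 0 ≤ A := Finset.sum_nonneg fun i _ => sq_nonneg _
      have hM : 0 ≤ M := (sq_nonneg _).trans hjen
      have h1 : A * c j ^ 2 * σ ^ 2 ≤ A * c j ^ 2 * M := by gcongr
      have h2 : 0 ≤ c j ^ 4 * M := by positivity
      nlinarith

end

lemma integral_exp_neg_sq_gaussianReal_le {ρ : ℝ} (hρ : 0 < ρ) :
    ∫ g, Real.exp (-((g / ρ) ^ 2 / 2)) ∂(gaussianReal 0 1) ≤ ρ := by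
  rw [integral_gaussianReal_eq_integral_smul (by norm_num)]
  have h1 : ∫ g : ℝ, (√(2 * Real.pi))⁻¹ * Real.exp (-(1 / (2 * ρ ^ 2)) * g ^ 2) = ρ := by
    rw [integral_const_mul, integral_gaussian]
    have : Real.pi / (1 / (2 * ρ ^ 2)) = (2 * Real.pi) * ρ ^ 2 := by field_simp
    rw [this, Real.sqrt_mul (x := 2 * Real.pi) (by positivity) (ρ ^ 2), Real.sqrt_sq hρ.le, ← mul_assoc,
      inv_mul_cancel₀ (by positivity), one_mul]
  refine le_of_le_of_eq ?_ h1
  refine integral_mono_of_nonneg (ae_of_all _ fun g => ?_) ?_ (ae_of_all _ fun g => ?_)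
  · exact smul_nonneg (gaussianPDFReal_nonneg _ _ _) (Real.exp_pos _).le
  · exact (integrable_exp_neg_mul_sq (by positivity)).const_mul _
  · simp only [gaussianPDFReal, smul_eq_mul, NNReal.coe_one, mul_one, sub_zero]
    rw [mul_assoc, ← Real.exp_add]
    gcongr
    have : -(g / ρ) ^ 2 / 2 = -(1 / (2 * ρ ^ 2)) * g ^ 2 := by field_simp
    have h2 : 0 ≤ g ^ 2 := sq_nonneg g
    linarith

/-- Anti-concentration at `0` from closeness of the characteristic function to the Gaussian one:
integrating the characteristic function of `S` against a Gaussian density gives the expectation of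
`exp (-S² / (2 ρ²))`, which dominates the probability that `|S| ≤ ρ`. -/
lemma measureReal_abs_le_le_of_charFun {Ω : Type*} [MeasurableSpace Ω] {ν : Measure Ω}
    [IsProbabilityMeasure ν] {S : Ω → ℝ} (hS : AEMeasurable S ν) {d ρ : ℝ} (hρ : 0 < ρ)
    (h : ∀ t : ℝ, ‖∫ ω, Complex.exp ((t * S ω : ℝ) * Complex.I) ∂ν -
      Complex.exp ((-(t ^ 2 / 2) : ℝ))‖ ≤ (8 * |t| ^ 3 + t ^ 4) * d) :
    ν.real {ω | |S ω| ≤ ρ} ≤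
      2 * (ρ + (∫ g, (8 * |g / ρ| ^ 3 + (g / ρ) ^ 4) ∂(gaussianReal 0 1)) * d) := by
  set γ := gaussianReal 0 1
  have hE : ∀ ω, Complex.exp ((-((S ω / ρ) ^ 2 / 2) : ℝ)) =
      ∫ g, Complex.exp ((g / ρ * S ω : ℝ) * Complex.I) ∂γ := fun ω => by
    have h1 := charFun_gaussianReal (μ := 0) (v := 1) (S ω / ρ)
    rw [charFun_apply_real] at h1
    have h2 : ∀ g : ℝ, ((S ω / ρ : ℝ) : ℂ) * g * Complex.I =
        (g / ρ * S ω : ℝ) * Complex.I := fun g => by push_cast; ring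
    simp_rw [h2] at h1
    rw [h1]
    congr 1
    push_cast
    ring
  have hmem : ∀ p : ℕ, Integrable (fun g : ℝ => |g| ^ p) γ := fun p => by
    rcases Nat.eq_zero_or_pos p with rfl | hp
    · simp
    · exact (memLp_id_gaussianReal (μ := 0) (v := 1) p).integrable_norm_pow hp.ne'
  have hpoly : Integrable (fun g : ℝ => 8 * |g / ρ| ^ 3 + (g / ρ) ^ 4) γ := by
    have := ((hmem 3).const_mul (8 / ρ ^ 3)).add ((hmem 4).const_mul (1 / ρ ^ 4))
    refine this.congr (ae_of_all _ fun g => ?_)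
    have : |g| ^ 4 = g ^ 4 := by rw [← abs_pow, abs_of_nonneg (by positivity)]
    simp only [Pi.add_apply, abs_div, abs_of_pos hρ, div_pow, this]
    ring
  have hexpI : Integrable (fun g : ℝ => Real.exp (-((g / ρ) ^ 2 / 2))) γ := by
    refine Integrable.of_bound (by fun_prop) 1 (ae_of_all _ fun g => ?_)
    rw [Real.norm_eq_abs, Real.abs_exp, Real.exp_le_one_iff, neg_nonpos]
    positivity
  have hSI : Integrable (fun ω => Real.exp (-((S ω / ρ) ^ 2 / 2))) ν := by
    refine Integrable.of_bound (AEMeasurable.aestronglyMeasurable (by fun_prop)) 1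
      (ae_of_all _ fun g => ?_)
    rw [Real.norm_eq_abs, Real.abs_exp, Real.exp_le_one_iff, neg_nonpos]
    positivity
  have hswap : ((∫ ω, Real.exp (-((S ω / ρ) ^ 2 / 2)) ∂ν : ℝ) : ℂ) =
      ∫ g, ∫ ω, Complex.exp ((g / ρ * S ω : ℝ) * Complex.I) ∂ν ∂γ := by
    rw [← integral_integral_swap, ← integral_complex_ofReal]
    · refine integral_congr_ae (ae_of_all _ fun ω => ?_)
      simp only [Complex.ofReal_exp]
      exact hE ω
    · have hS' : AEMeasurable (fun z : Ω × ℝ => S z.1) (ν.prod γ) := hS.comp_fst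
      refine Integrable.of_bound (C := 1) ?_ (ae_of_all _ fun z => ?_)
      · refine AEMeasurable.aestronglyMeasurable ?_
        simp only [Function.uncurry_def]
        fun_prop
      · exact (Complex.norm_exp_ofReal_mul_I _).le
  have hbound : ∫ ω, Real.exp (-((S ω / ρ) ^ 2 / 2)) ∂ν ≤
      ρ + (∫ g, (8 * |g / ρ| ^ 3 + (g / ρ) ^ 4) ∂γ) * d := by
    have h1 : ‖((∫ ω, Real.exp (-((S ω / ρ) ^ 2 / 2)) ∂ν : ℝ) : ℂ)‖ ≤
        ∫ g, (Real.exp (-((g / ρ) ^ 2 / 2)) + (8 * |g / ρ| ^ 3 + (g / ρ) ^ 4) * d) ∂γ := by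
      rw [hswap]
      refine norm_integral_le_of_norm_le (hexpI.add (hpoly.mul_const d)) (ae_of_all _ fun g => ?_)
      have h2 := h (g / ρ)
      have h3 : ‖Complex.exp ((-((g / ρ) ^ 2 / 2) : ℝ))‖ = Real.exp (-((g / ρ) ^ 2 / 2)) := by
        rw [← Complex.ofReal_exp, Complex.norm_real, Real.norm_eq_abs, Real.abs_exp]
      rw [← h3]
      calc _ ≤ _ := norm_le_norm_add_norm_sub' _ (Complex.exp ((-((g / ρ) ^ 2 / 2) : ℝ)))
        _ ≤ _ := by gcongr
    rw [integral_add hexpI (hpoly.mul_const d), integral_mul_const] at h1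
    rw [Complex.norm_real, Real.norm_eq_abs] at h1
    exact (le_abs_self _).trans (h1.trans (by gcongr; exact integral_exp_neg_sq_gaussianReal_le hρ))
  have hmark := mul_meas_ge_le_integral_of_nonneg (ae_of_all _ fun ω => (Real.exp_pos _).le) hSI
    (Real.exp (-(1 / 2)))
  have hsub : {ω | |S ω| ≤ ρ} ⊆
      {ω | Real.exp (-(1 / 2)) ≤ Real.exp (-((S ω / ρ) ^ 2 / 2))} := fun ω hω => by
    simp only [Set.mem_ofPred_eq, Real.exp_le_exp, neg_le_neg_iff] at hω ⊢
    have : (S ω / ρ) ^ 2 ≤ 1 := by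
      rw [sq_le_one_iff_abs_le_one, abs_div, abs_of_pos hρ]
      exact (div_le_one hρ).2 hω
    linarith
  have hmono : ν.real {ω | |S ω| ≤ ρ} ≤
      ν.real {ω | Real.exp (-(1 / 2)) ≤ Real.exp (-((S ω / ρ) ^ 2 / 2))} := measureReal_mono hsub
  have hhalf : (1 : ℝ) / 2 ≤ Real.exp (-(1 / 2)) := by
    have := Real.add_one_le_exp (-(1 / 2 : ℝ))
    linarith
  have h0 : 0 ≤ ν.real {ω | |S ω| ≤ ρ} := measureReal_nonneg
  nlinarith

/-- Uniform anti-concentration at `0` of weighted i.i.d. sums of variance `1` with a small sum of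
fourth moments. -/
lemma exists_measureReal_abs_weighted_sum_le {ε : ℝ} (hε : 0 < ε) :
    ∃ ρ > 0, ∃ η > 0, ∀ {ι : Type} [Fintype ι] (P : Measure 𝒳)
      [IsProbabilityMeasure P] (f : 𝒳 → ℝ) (c : ι → ℝ),
      MemLp f 4 P → ∫ x, f x ∂P = 0 → (∑ i, c i ^ 2) * ∫ x, f x ^ 2 ∂P = 1 →
      (∑ i, c i ^ 4) * ∫ x, f x ^ 4 ∂P ≤ η →
      (Measure.pi fun _ => P).real {w : ι → 𝒳 | |∑ i, c i * f (w i)| ≤ ρ} ≤ ε := by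
  -- the bound to be met is `2 * (ρ + C * d)`
  set ρ := ε / 4 with hρ
  have hρ0 : 0 < ρ := by positivity
  set C := ∫ g, (8 * |g / ρ| ^ 3 + (g / ρ) ^ 4) ∂(gaussianReal 0 1)
  have hC : 0 ≤ C := integral_nonneg fun g => by positivity
  set d := min 1 (ε / (4 * (C + 1))) with hd
  have hd0 : 0 < d := by positivity
  refine ⟨ρ, hρ0, d ^ 2, by positivity, fun {ι} _ P _ f c hf h0 hvar hL => ?_⟩
  have hm : AEMeasurable (fun w : ι → 𝒳 => ∑ i, c i * f (w i)) (Measure.pi fun _ => P) :=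
    (moments_weighted_sum hf h0 c Finset.univ).1.1.aemeasurable
  refine (measureReal_abs_le_le_of_charFun hm hρ0 fun t =>
    norm_charFun_weighted_sum_sub_le' hf h0 c hvar hd0 (min_le_left _ _) hL t).trans ?_
  have h1 : C * d ≤ C * (ε / (4 * (C + 1))) := by gcongr; exact min_le_right _ _
  have h2 : C * (ε / (4 * (C + 1))) ≤ ε / 4 := by
    rw [mul_div_assoc', div_le_div_iff₀ (by positivity) (by norm_num)]
    nlinarith
  linarith

end CrossMMD

/-! ### Quadratic forms in i.i.d. centred features -/

namespace CrossMMD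

universe v

variable {𝒳 : Type*} [MeasurableSpace 𝒳] {P : Measure 𝒳} {ι : Type*}
  {H : Type v} [NormedAddCommGroup H] [InnerProductSpace ℝ H]

/-- A function of the coordinates in `S` and of one further coordinate `j` has integral zero as soon
as it is centred in the coordinate `j`. -/
lemma integral_pi_eq_zero_of_centered [Fintype ι] [IsProbabilityMeasure P] {S : Finset ι} {j : ι}
    (hj : j ∉ S) {F : (S → 𝒳) → 𝒳 → ℝ} (hF : Measurable (Function.uncurry F))
    (h0 : ∀ a, ∫ y, F a y ∂P = 0) :
    ∫ w : ι → 𝒳, F (fun i => w i) (w j) ∂(Measure.pi fun _ => P) = 0 := by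
  set μ : Measure (ι → 𝒳) := Measure.pi fun _ => P
  have hind : iIndepFun (fun (i : ι) (w : ι → 𝒳) => w i) μ :=
    iIndepFun_pi (μ := fun _ : ι => P) (X := fun _ => id) fun _ => aemeasurable_id
  have h1 : IndepFun (fun (w : ι → 𝒳) (i : S) => w i) (fun w : ι → 𝒳 => w j) μ :=
    (hind.indepFun_finset S {j} (Finset.disjoint_singleton_right.2 hj)
      (fun i => measurable_pi_apply i)).comp (φ := id)
      (ψ := fun u : ({j} : Finset ι) → 𝒳 => u ⟨j, Finset.mem_singleton_self j⟩) measurable_id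
      (measurable_pi_apply _)
  have hm1 : Measurable (fun (w : ι → 𝒳) (i : S) => w i) := by fun_prop
  have hmap := (indepFun_iff_map_prod_eq_prod_map_map hm1.aemeasurable
    (measurable_pi_apply j).aemeasurable).1 h1
  have hev : μ.map (fun w : ι → 𝒳 => w j) = P := (measurePreserving_eval (fun _ : ι => P) j).map_eq
  rw [hev] at hmap
  have : IsProbabilityMeasure (μ.map fun (w : ι → 𝒳) (i : S) => w i) :=
    Measure.isProbabilityMeasure_map hm1.aemeasurable
  have h2 : ∫ w : ι → 𝒳, F (fun i => w i) (w j) ∂μ =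
      ∫ z, Function.uncurry F z ∂((μ.map fun (w : ι → 𝒳) (i : S) => w i).prod P) := by
    rw [← hmap, integral_map (by fun_prop) hF.aestronglyMeasurable]
    rfl
  rw [h2]
  -- without integrability the integral is `0` by convention
  by_cases hI : Integrable (Function.uncurry F) ((μ.map fun (w : ι → 𝒳) (i : S) => w i).prod P)
  · rw [integral_prod _ hI]
    simp [Function.uncurry, h0]
  · exact integral_undef hI

lemma measurePreserving_pair [Fintype ι] [IsProbabilityMeasure P] {i j : ι} (hij : i ≠ j) :
    MeasurePreserving (fun w : ι → 𝒳 => (w i, w j)) (Measure.pi fun _ => P) (P.prod P) := by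
  have hind : iIndepFun (fun (i : ι) (w : ι → 𝒳) => w i) (Measure.pi fun _ => P) :=
    iIndepFun_pi (μ := fun _ : ι => P) (X := fun _ => id) fun _ => aemeasurable_id
  have h := (indepFun_iff_map_prod_eq_prod_map_map (measurable_pi_apply i).aemeasurable
    (measurable_pi_apply j).aemeasurable).1 (hind.indepFun hij)
  rw [(measurePreserving_eval (fun _ : ι => P) i).map_eq,
    (measurePreserving_eval (fun _ : ι => P) j).map_eq] at h
  exact ⟨by fun_prop, h⟩

/-- A feature map `Φ : 𝒳 → H` that is centred and has a finite fourth moment, both expressed through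
the Gram kernel `⟪Φ x, Φ y⟫`; no measurability of `Φ` itself is asked for. -/
structure IsCenteredFeature (P : Measure 𝒳) (Φ : 𝒳 → H) : Prop where
  measurable_inner : Measurable fun z : 𝒳 × 𝒳 => ⟪Φ z.1, Φ z.2⟫_ℝ
  integral_inner : ∀ x, ∫ y, ⟪Φ x, Φ y⟫_ℝ ∂P = 0
  integrable_norm_pow : Integrable (fun x => ‖Φ x‖ ^ 4) P

namespace IsCenteredFeature

variable {Φ : 𝒳 → H}

lemma measurable_norm_sq (h : IsCenteredFeature P Φ) : Measurable fun x => ‖Φ x‖ ^ 2 := by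
  simpa [Function.comp_def, real_inner_self_eq_norm_sq] using
    h.measurable_inner.comp (measurable_id.prodMk measurable_id)

lemma measurable_inner_left (h : IsCenteredFeature P Φ) (x : 𝒳) :
    Measurable fun y => ⟪Φ x, Φ y⟫_ℝ :=
  h.measurable_inner.comp measurable_prodMk_left

lemma memLp_norm_sq (h : IsCenteredFeature P Φ) : MemLp (fun x => ‖Φ x‖ ^ 2) 2 P := by
  rw [memLp_two_iff_integrable_sq h.measurable_norm_sq.aestronglyMeasurable]
  refine h.integrable_norm_pow.congr (ae_of_all _ fun x => ?_)
  simp only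
  ring

lemma integrable_norm_sq [IsFiniteMeasure P] (h : IsCenteredFeature P Φ) :
    Integrable (fun x => ‖Φ x‖ ^ 2) P :=
  h.memLp_norm_sq.integrable (by norm_num)

lemma inner_sq_le (x y : H) : ⟪x, y⟫_ℝ ^ 2 ≤ ‖x‖ ^ 2 * ‖y‖ ^ 2 := by
  rw [← mul_pow, ← sq_abs]
  exact pow_le_pow_left₀ (abs_nonneg _) (abs_real_inner_le_norm x y) 2

lemma memLp_inner_left [IsFiniteMeasure P] (h : IsCenteredFeature P Φ) (x : 𝒳) :
    MemLp (fun y => ⟪Φ x, Φ y⟫_ℝ) 4 P := by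
  have hm := (h.measurable_inner_left x).aestronglyMeasurable (μ := P)
  rw [← integrable_norm_rpow_iff hm (by norm_num) (by norm_num)]
  have h4 : ((4 : ENNReal).toReal) = ((4 : ℕ) : ℝ) := by norm_num
  simp_rw [h4, Real.rpow_natCast]
  refine (h.integrable_norm_pow.const_mul (‖Φ x‖ ^ 4)).mono (hm.norm.pow 4)
    (ae_of_all _ fun y => ?_)
  rw [← mul_pow, norm_pow, norm_pow, norm_norm, Real.norm_eq_abs, Real.norm_eq_abs,
    abs_of_nonneg (a := ‖Φ x‖ * ‖Φ y‖) (by positivity)]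
  exact pow_le_pow_left₀ (abs_nonneg _) (abs_real_inner_le_norm _ _) 4

lemma memLp_inner [IsFiniteMeasure P] (h : IsCenteredFeature P Φ) :
    MemLp (fun z : 𝒳 × 𝒳 => ⟪Φ z.1, Φ z.2⟫_ℝ) 2 (P.prod P) := by
  rw [memLp_two_iff_integrable_sq h.measurable_inner.aestronglyMeasurable]
  refine (h.integrable_norm_sq.mul_prod h.integrable_norm_sq).mono
    (h.measurable_inner.pow_const 2).aestronglyMeasurable (ae_of_all _ fun z => ?_)
  rw [Real.norm_eq_abs, Real.norm_eq_abs, abs_of_nonneg (by positivity),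
    abs_of_nonneg (by positivity)]
  exact inner_sq_le _ _

/-- Products of the Gram kernel at two different pairs of sample points are orthogonal. -/
lemma integral_inner_mul_inner_eq_zero [Fintype ι] [IsProbabilityMeasure P]
    (h : IsCenteredFeature P Φ) {i j k l : ι} (hij : i ≠ j) (hjk : j ≠ k) (hjl : j ≠ l) :
    ∫ w : ι → 𝒳, ⟪Φ (w i), Φ (w j)⟫_ℝ * ⟪Φ (w k), Φ (w l)⟫_ℝ ∂(Measure.pi fun _ => P) = 0 := by
  classical
  have hj : j ∉ ({i, k, l} : Finset ι) := by simp [hij.symm, hjk, hjl]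
  refine integral_pi_eq_zero_of_centered (S := {i, k, l}) hj
    (F := fun a y => ⟪Φ (a ⟨i, by simp⟩), Φ y⟫_ℝ * ⟪Φ (a ⟨k, by simp⟩), Φ (a ⟨l, by simp⟩)⟫_ℝ)
    ?_ fun a => ?_
  · have h1 : Measurable fun z : (({i, k, l} : Finset ι) → 𝒳) × 𝒳 =>
        (z.1 ⟨i, by simp⟩, z.2) := by fun_prop
    have h2 : Measurable fun z : (({i, k, l} : Finset ι) → 𝒳) × 𝒳 =>
        (z.1 ⟨k, by simp⟩, z.1 ⟨l, by simp⟩) := by fun_prop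
    exact (h.measurable_inner.comp h1).mul (h.measurable_inner.comp h2)
  · rw [integral_mul_const, h.integral_inner, zero_mul]

/-- The second moment of the off-diagonal part of a quadratic form in i.i.d. centred features. -/
lemma integral_offDiag_sq_le [Fintype ι] [DecidableEq ι] [IsProbabilityMeasure P]
    (h : IsCenteredFeature P Φ) (a : ι → ℝ) :
    MemLp (fun w : ι → 𝒳 => ∑ p ∈ (Finset.univ : Finset ι).offDiag,
      a p.1 * a p.2 * ⟪Φ (w p.1), Φ (w p.2)⟫_ℝ) 2 (Measure.pi fun _ => P) ∧
    ∫ w : ι → 𝒳, (∑ p ∈ (Finset.univ : Finset ι).offDiag,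
      a p.1 * a p.2 * ⟪Φ (w p.1), Φ (w p.2)⟫_ℝ) ^ 2 ∂(Measure.pi fun _ => P) ≤
    2 * (∑ i, a i ^ 2) ^ 2 * ∫ z, ⟪Φ z.1, Φ z.2⟫_ℝ ^ 2 ∂(P.prod P) := by
  set μ : Measure (ι → 𝒳) := Measure.pi fun _ => P
  set e := ∫ z, ⟪Φ z.1, Φ z.2⟫_ℝ ^ 2 ∂(P.prod P) with he
  have he0 : 0 ≤ e := integral_nonneg fun z => sq_nonneg _
  set G : ι × ι → (ι → 𝒳) → ℝ := fun p w => ⟪Φ (w p.1), Φ (w p.2)⟫_ℝ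
  have hL : ∀ p ∈ (Finset.univ : Finset ι).offDiag, MemLp (G p) 2 μ := fun p hp =>
    h.memLp_inner.comp_measurePreserving (measurePreserving_pair (Finset.mem_offDiag.1 hp).2.2)
  have hself : ∀ p ∈ (Finset.univ : Finset ι).offDiag, ∫ w, G p w * G p w ∂μ = e := fun p hp => by
    have hp' := measurePreserving_pair (P := P) (Finset.mem_offDiag.1 hp).2.2
    rw [he, ← hp'.map_eq, integral_map hp'.measurable.aemeasurable
      (h.measurable_inner.pow_const 2).aestronglyMeasurable]
    simp [G, sq, μ]
  have hswap : ∀ p : ι × ι, G p.swap = G p := fun p => by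
    ext w
    exact real_inner_comm _ _
  have hcross : ∀ p ∈ (Finset.univ : Finset ι).offDiag, ∀ r ∈ (Finset.univ : Finset ι).offDiag,
      ∫ w, G p w * G r w ∂μ = if r = p ∨ r = p.swap then e else 0 := by
    intro p hp r hr
    split_ifs with hpr
    · rcases hpr with rfl | rfl
      · exact hself _ hp
      · rw [hswap]
        exact hself _ hp
    · obtain ⟨i, j⟩ := p
      obtain ⟨k, l⟩ := r
      have hij : i ≠ j := (Finset.mem_offDiag.1 hp).2.2
      have hkl : k ≠ l := (Finset.mem_offDiag.1 hr).2.2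
      simp only [Prod.mk.injEq, Prod.swap_prod_mk, not_or, not_and] at hpr
      -- an index that occurs in only one of the two pairs makes the expectation vanish; by symmetry
      -- of the Gram kernel it may be taken to be the second index of its pair
      by_cases hj : j ≠ k ∧ j ≠ l
      · exact h.integral_inner_mul_inner_eq_zero hij hj.1 hj.2
      · rw [← hswap (i, j)]
        refine h.integral_inner_mul_inner_eq_zero hij.symm ?_ ?_ <;> grind
  have hterm : ∀ p ∈ (Finset.univ : Finset ι).offDiag,
      MemLp (fun w => a p.1 * a p.2 * G p w) 2 μ := fun p hp => (hL p hp).const_mul _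
  refine ⟨memLp_finsetSum _ hterm, ?_⟩
  have hexp : ∀ w, (∑ p ∈ (Finset.univ : Finset ι).offDiag, a p.1 * a p.2 * G p w) ^ 2 =
      ∑ p ∈ (Finset.univ : Finset ι).offDiag, ∑ r ∈ (Finset.univ : Finset ι).offDiag,
        (a p.1 * a p.2) * (a r.1 * a r.2) * (G p w * G r w) := fun w => by
    rw [sq, Finset.sum_mul_sum]
    exact Finset.sum_congr rfl fun p _ => Finset.sum_congr rfl fun r _ => by ring
  have hIpr : ∀ p ∈ (Finset.univ : Finset ι).offDiag, ∀ r ∈ (Finset.univ : Finset ι).offDiag,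
      Integrable (fun w => (a p.1 * a p.2) * (a r.1 * a r.2) * (G p w * G r w)) μ :=
    fun p hp r hr => ((hL p hp).integrable_mul (hL r hr)).const_mul _
  change ∫ w, (∑ p ∈ (Finset.univ : Finset ι).offDiag, a p.1 * a p.2 * G p w) ^ 2 ∂μ ≤ _
  simp_rw [hexp]
  rw [integral_finsetSum _ fun p hp => integrable_finsetSum _ fun r hr => hIpr p hp r hr]
  have hval : ∀ p ∈ (Finset.univ : Finset ι).offDiag,
      ∫ w, ∑ r ∈ (Finset.univ : Finset ι).offDiag,
        (a p.1 * a p.2) * (a r.1 * a r.2) * (G p w * G r w) ∂μ ≤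
        2 * e * (a p.1 ^ 2 * a p.2 ^ 2) := by
    intro p hp
    rw [integral_finsetSum _ fun r hr => hIpr p hp r hr]
    -- each pair is matched by itself and by its swap, whence the factor `2`
    have hr : ∀ r ∈ (Finset.univ : Finset ι).offDiag,
        ∫ w, (a p.1 * a p.2) * (a r.1 * a r.2) * (G p w * G r w) ∂μ ≤
          (if r = p then e * (a p.1 ^ 2 * a p.2 ^ 2) else 0) +
            if r = p.swap then e * (a p.1 ^ 2 * a p.2 ^ 2) else 0 := by
      intro r hr
      rw [integral_const_mul, hcross p hp r hr]
      have h0 : 0 ≤ e * (a p.1 ^ 2 * a p.2 ^ 2) := by positivity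
      by_cases h1 : r = p
      · subst h1
        simp only [true_or, if_true]
        have : a r.1 * a r.2 * (a r.1 * a r.2) * e = e * (a r.1 ^ 2 * a r.2 ^ 2) := by ring
        rw [this]
        split_ifs <;> linarith
      · by_cases h2 : r = p.swap
        · subst h2
          simp only [or_true, if_true, Prod.fst_swap, Prod.snd_swap, if_neg h1]
          exact le_of_eq (by ring)
        · simp [h1, h2]
    refine (Finset.sum_le_sum hr).trans ?_
    have h0 : 0 ≤ e * (a p.1 ^ 2 * a p.2 ^ 2) := by positivity
    rw [Finset.sum_add_distrib, Finset.sum_ite_eq', Finset.sum_ite_eq']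
    split_ifs <;> linarith
  refine (Finset.sum_le_sum hval).trans ?_
  rw [← Finset.mul_sum]
  have h1 : ∑ p ∈ (Finset.univ : Finset ι).offDiag, a p.1 ^ 2 * a p.2 ^ 2 ≤
      (∑ i, a i ^ 2) ^ 2 := by
    rw [sq, Finset.sum_mul_sum, ← Finset.sum_product']
    exact Finset.sum_le_sum_of_subset_of_nonneg (fun p _ => by simp) fun p _ _ => by positivity
  nlinarith

lemma norm_sq_weighted_sum {α : Type*} [Fintype ι] [DecidableEq ι] (Φ : α → H) (a : ι → ℝ)
    (w : ι → α) :
    ‖∑ i, a i • Φ (w i)‖ ^ 2 = ∑ i, a i ^ 2 * ‖Φ (w i)‖ ^ 2 +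
      ∑ p ∈ (Finset.univ : Finset ι).offDiag, a p.1 * a p.2 * ⟪Φ (w p.1), Φ (w p.2)⟫_ℝ := by
  rw [← real_inner_self_eq_norm_sq, sum_inner]
  simp_rw [inner_sum, inner_smul_left, inner_smul_right]
  rw [← Finset.sum_product' (s := Finset.univ) (t := Finset.univ)
    (f := fun i j => (starRingEnd ℝ) (a i) * (a j * ⟪Φ (w i), Φ (w j)⟫_ℝ)),
    ← Finset.diag_union_offDiag, Finset.sum_union (Finset.disjoint_diag_offDiag _),
    Finset.sum_diag]
  congr 1
  · refine Finset.sum_congr rfl fun i _ => ?_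
    simp
    ring
  · refine Finset.sum_congr rfl fun p _ => ?_
    simp
    ring

/-- Concentration of `‖∑ aᵢ Φ(wᵢ)‖²` around its mean when the Hilbert-Schmidt norm of the
covariance of `Φ` is small compared with its trace. -/
lemma measureReal_norm_sq_le_half [Fintype ι] [IsProbabilityMeasure P]
    (h : IsCenteredFeature P Φ) (a : ι → ℝ) (hs : 0 < ∑ i, a i ^ 2)
    (hq : 0 < ∫ x, ‖Φ x‖ ^ 2 ∂P) :
    (Measure.pi fun _ => P).real {w : ι → 𝒳 |
      ‖∑ i, a i • Φ (w i)‖ ^ 2 ≤ 1 / 2 * ((∑ i, a i ^ 2) * ∫ x, ‖Φ x‖ ^ 2 ∂P)} ≤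
    16 * ((∫ z, ⟪Φ z.1, Φ z.2⟫_ℝ ^ 2 ∂(P.prod P)) / (∫ x, ‖Φ x‖ ^ 2 ∂P) ^ 2) +
      8 * (((∑ i, a i ^ 4) * ∫ x, ‖Φ x‖ ^ 4 ∂P) /
        ((∑ i, a i ^ 2) * ∫ x, ‖Φ x‖ ^ 2 ∂P) ^ 2) := by
  classical
  set μ : Measure (ι → 𝒳) := Measure.pi fun _ => P
  set q := ∫ x, ‖Φ x‖ ^ 2 ∂P
  set Q := ∫ x, ‖Φ x‖ ^ 4 ∂P
  set s := ∑ i, a i ^ 2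
  set e := ∫ z, ⟪Φ z.1, Φ z.2⟫_ℝ ^ 2 ∂(P.prod P)
  set D₁ : (ι → 𝒳) → ℝ := fun w => ∑ i, a i ^ 2 * ‖Φ (w i)‖ ^ 2 - s * q with hD₁
  set D₂ : (ι → 𝒳) → ℝ := fun w => ∑ p ∈ (Finset.univ : Finset ι).offDiag,
    a p.1 * a p.2 * ⟪Φ (w p.1), Φ (w p.2)⟫_ℝ with hD₂
  obtain ⟨hD₂L, hD₂e⟩ := h.integral_offDiag_sq_le a
  have hXL : ∀ i, MemLp (fun x => a i ^ 2 * ‖Φ x‖ ^ 2) 2 P := fun i => h.memLp_norm_sq.const_mul _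
  have hXLμ : ∀ i, MemLp (fun w : ι → 𝒳 => a i ^ 2 * ‖Φ (w i)‖ ^ 2) 2 μ := fun i =>
    (hXL i).comp_measurePreserving (measurePreserving_eval (fun _ : ι => P) i)
  have hmean : ∫ w, ∑ i, a i ^ 2 * ‖Φ (w i)‖ ^ 2 ∂μ = s * q := by
    rw [integral_finsetSum _ fun i _ => (hXLμ i).integrable (by norm_num), Finset.sum_mul]
    refine Finset.sum_congr rfl fun i _ => ?_
    rw [integral_const_mul]
    congr 1
    exact integral_comp_eval (μ := fun _ : ι => P) (i := i) (f := fun x => ‖Φ x‖ ^ 2)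
      h.measurable_norm_sq.aestronglyMeasurable
  have hD₁L : MemLp D₁ 2 μ := (memLp_finsetSum _ fun i _ => hXLμ i).sub (memLp_const _)
  have hD₁e : ∫ w, D₁ w ^ 2 ∂μ ≤ (∑ i, a i ^ 4) * Q := by
    have hv := variance_sum_pi (μ := fun _ : ι => P) hXL
    rw [variance_eq_integral (by
      exact (memLp_finsetSum' _ fun i _ => hXLμ i).1.aemeasurable)] at hv
    simp only [Finset.sum_apply] at hv
    change ∫ w, (∑ i, a i ^ 2 * ‖Φ (w i)‖ ^ 2 -
      ∫ w, ∑ i, a i ^ 2 * ‖Φ (w i)‖ ^ 2 ∂μ) ^ 2 ∂μ = _ at hv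
    rw [hmean] at hv
    rw [hD₁, hv, Finset.sum_mul]
    refine Finset.sum_le_sum fun i _ => ?_
    refine (variance_le_expectation_sq (hXL i).1).trans (le_of_eq ?_)
    rw [← integral_const_mul]
    congr with x
    simp
    ring
  have hDL : MemLp (fun w => D₁ w + D₂ w) 2 μ := hD₁L.add hD₂L
  have hDe : ∫ w, (D₁ w + D₂ w) ^ 2 ∂μ ≤ 2 * ((∑ i, a i ^ 4) * Q) + 4 * s ^ 2 * e := by
    have hsum : Integrable (fun w => 2 * D₁ w ^ 2 + 2 * D₂ w ^ 2) μ :=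
      (hD₁L.integrable_sq.const_mul 2).add (hD₂L.integrable_sq.const_mul 2)
    refine (integral_mono hDL.integrable_sq hsum fun w => ?_).trans ?_
    · simp only
      nlinarith [sq_nonneg (D₁ w - D₂ w)]
    · rw [integral_add (hD₁L.integrable_sq.const_mul 2) (hD₂L.integrable_sq.const_mul 2),
        integral_const_mul, integral_const_mul]
      linarith
  have hsq : 0 < s * q := mul_pos hs hq
  have hmark := mul_meas_ge_le_integral_of_nonneg (ae_of_all _ fun w => sq_nonneg (D₁ w + D₂ w))
    hDL.integrable_sq ((s * q) ^ 2 / 4)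
  have hsub : {w : ι → 𝒳 | ‖∑ i, a i • Φ (w i)‖ ^ 2 ≤ 1 / 2 * (s * q)} ⊆
      {w | (s * q) ^ 2 / 4 ≤ (D₁ w + D₂ w) ^ 2} := fun w hw => by
    simp only [Set.mem_ofPred_eq] at hw ⊢
    rw [norm_sq_weighted_sum] at hw
    have : D₁ w + D₂ w ≤ -(s * q / 2) := by
      simp only [hD₁, hD₂]
      linarith
    nlinarith
  have hmono : μ.real {w : ι → 𝒳 | ‖∑ i, a i • Φ (w i)‖ ^ 2 ≤ 1 / 2 * (s * q)} ≤
      μ.real {w | (s * q) ^ 2 / 4 ≤ (D₁ w + D₂ w) ^ 2} := measureReal_mono hsub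
  refine hmono.trans ?_
  have h5 := hmark.trans hDe
  have h6 : 16 * (e / q ^ 2) + 8 * (((∑ i, a i ^ 4) * Q) / (s * q) ^ 2) =
      (2 * ((∑ i, a i ^ 4) * Q) + 4 * s ^ 2 * e) / ((s * q) ^ 2 / 4) := by
    field_simp
    ring
  rw [h6, le_div_iff₀ (by positivity)]
  linarith

/-- If the Hilbert-Schmidt norm of the covariance is not zero, then some direction `Φ z₀ / ‖Φ z₀‖`
carries a share of the trace that is comparable to the squared ratio of the two. -/
lemma exists_direction [IsProbabilityMeasure P] (h : IsCenteredFeature P Φ)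
    (he : 0 < ∫ z, ⟪Φ z.1, Φ z.2⟫_ℝ ^ 2 ∂(P.prod P)) (hq : 0 < ∫ x, ‖Φ x‖ ^ 2 ∂P) :
    ∃ z₀, 0 < ‖Φ z₀‖ ^ 2 ∧
      (∫ z, ⟪Φ z.1, Φ z.2⟫_ℝ ^ 2 ∂(P.prod P)) / (2 * ∫ x, ‖Φ x‖ ^ 2 ∂P) * ‖Φ z₀‖ ^ 2 <
        ∫ y, ⟪Φ z₀, Φ y⟫_ℝ ^ 2 ∂P := by
  set q := ∫ x, ‖Φ x‖ ^ 2 ∂P with hqdef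
  set e := ∫ z, ⟪Φ z.1, Φ z.2⟫_ℝ ^ 2 ∂(P.prod P)
  have hprod : e = ∫ x, ∫ y, ⟪Φ x, Φ y⟫_ℝ ^ 2 ∂P ∂P :=
    integral_prod _ h.memLp_inner.integrable_sq
  have hex : ∃ z₀, e / (2 * q) * ‖Φ z₀‖ ^ 2 < ∫ y, ⟪Φ z₀, Φ y⟫_ℝ ^ 2 ∂P := by
    by_contra! hc
    have h1 : e ≤ ∫ z, e / (2 * q) * ‖Φ z‖ ^ 2 ∂P := by
      refine hprod.trans_le ?_
      exact integral_mono h.memLp_inner.integrable_sq.integral_prod_left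
        (h.integrable_norm_sq.const_mul _) hc
    rw [integral_const_mul, ← hqdef] at h1
    have h2 : e / (2 * q) * q = e / 2 := by field_simp
    linarith
  obtain ⟨z₀, hz⟩ := hex
  refine ⟨z₀, ?_, hz⟩
  by_contra hn
  have h0 : ‖Φ z₀‖ ^ 2 = 0 := le_antisymm (not_lt.1 hn) (sq_nonneg _)
  have h1 : Φ z₀ = 0 := by simpa using h0
  simp [h1] at hz

end IsCenteredFeature

/-- Uniform lower tail of `‖∑ aᵢ Φ(wᵢ)‖²`. Either the covariance of `Φ` has a small Hilbert-Schmidt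
norm and the squared norm concentrates, or a single direction carries a fixed share of its mean, and
the projection to that direction is asymptotically Gaussian and thus does not concentrate at `0`. -/
lemma exists_measureReal_norm_sq_le {ε : ℝ} (hε : 0 < ε) :
    ∃ δ > 0, ∃ η > 0, ∀ {ι : Type} [Fintype ι] (P : Measure 𝒳) [IsProbabilityMeasure P]
      {H : Type v} [NormedAddCommGroup H] [InnerProductSpace ℝ H] (Φ : 𝒳 → H) (a : ι → ℝ),
      IsCenteredFeature P Φ → 0 < ∑ i, a i ^ 2 → 0 < ∫ x, ‖Φ x‖ ^ 2 ∂P →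
      (∑ i, a i ^ 4) * ∫ x, ‖Φ x‖ ^ 4 ∂P ≤ η * ((∑ i, a i ^ 2) * ∫ x, ‖Φ x‖ ^ 2 ∂P) ^ 2 →
      (Measure.pi fun _ => P).real {w : ι → 𝒳 |
        ‖∑ i, a i • Φ (w i)‖ ^ 2 ≤ δ * ((∑ i, a i ^ 2) * ∫ x, ‖Φ x‖ ^ 2 ∂P)} ≤ ε := by
  obtain ⟨ρ, hρ, η₀, hη₀, hsb⟩ := exists_measureReal_abs_weighted_sum_le (𝒳 := 𝒳) hε
  -- the threshold for the squared ratio of the Hilbert-Schmidt norm to the trace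
  set r := ε / 32 with hr
  have hr0 : 0 < r := by positivity
  refine ⟨min (1 / 2) (ρ ^ 2 * (r / 2)), by positivity, min (ε / 16) (η₀ * (r / 2) ^ 2),
    by positivity, ?_⟩
  intro ι _ P _ H _ _ Φ a h hs hq hL
  set q := ∫ x, ‖Φ x‖ ^ 2 ∂P
  set Q := ∫ x, ‖Φ x‖ ^ 4 ∂P with hQ
  set s := ∑ i, a i ^ 2 with hsdef
  set e := ∫ z, ⟪Φ z.1, Φ z.2⟫_ℝ ^ 2 ∂(P.prod P) with he
  have hsq : 0 < s * q := mul_pos hs hq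
  rcases le_or_gt e (r * q ^ 2) with hcase | hcase
  · refine (measureReal_mono fun w hw => ?_).trans
      ((h.measureReal_norm_sq_le_half a hs hq).trans (?_ : _ ≤ ε))
    · simp only [Set.mem_ofPred_eq] at hw ⊢
      exact hw.trans (by gcongr; exact min_le_left _ _)
    · have h1 : e / q ^ 2 ≤ r := (div_le_iff₀ (by positivity)).2 hcase
      have h2 : ((∑ i, a i ^ 4) * Q) / (s * q) ^ 2 ≤ ε / 16 :=
        (div_le_iff₀ (by positivity)).2 (hL.trans (by gcongr; exact min_le_left _ _))
      linarith
  · have he0 : 0 < e := lt_of_le_of_lt (by positivity) hcase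
    obtain ⟨z₀, hz0, hz⟩ := h.exists_direction he0 hq
    set g := ‖Φ z₀‖ ^ 2 with hg
    set ψ : 𝒳 → ℝ := fun y => ⟪Φ z₀, Φ y⟫_ℝ / √g with hψ
    have hψL : MemLp ψ 4 P := by
      simpa [hψ, div_eq_mul_inv] using (h.memLp_inner_left z₀).mul_const (√g)⁻¹
    have hψ0 : ∫ y, ψ y ∂P = 0 := by
      rw [hψ, integral_div, h.integral_inner, zero_div]
    have hψsq : ∀ y, ψ y ^ 2 ≤ ‖Φ y‖ ^ 2 := fun y => by
      rw [hψ, div_pow, Real.sq_sqrt hz0.le, div_le_iff₀ hz0, mul_comm]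
      exact IsCenteredFeature.inner_sq_le _ _
    set σ := ∫ y, ψ y ^ 2 ∂P with hσ
    have hσr : r * q / 2 < σ := by
      have h1 : σ = (∫ y, ⟪Φ z₀, Φ y⟫_ℝ ^ 2 ∂P) / g := by
        simp_rw [hσ, hψ, div_pow, Real.sq_sqrt hz0.le]
        rw [integral_div]
      have h2 : r * q / 2 ≤ e / (2 * q) := by
        rw [div_le_div_iff₀ (by norm_num) (by positivity)]
        nlinarith
      rw [h1, lt_div_iff₀ hz0]
      exact (mul_le_mul_of_nonneg_right h2 hz0.le).trans_lt hz
    have hσ0 : 0 < σ := lt_trans (by positivity) hσr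
    have hsσ : 0 < s * σ := mul_pos hs hσ0
    have hψ4 : ∫ y, ψ y ^ 4 ∂P ≤ Q := by
      refine integral_mono (integrable_pow_of_memLp_four hψL le_rfl) h.integrable_norm_pow
        fun y => ?_
      have h1 : ψ y ^ 4 = (ψ y ^ 2) ^ 2 := by ring
      have h2 : ‖Φ y‖ ^ 4 = (‖Φ y‖ ^ 2) ^ 2 := by ring
      simp only
      rw [h1, h2]
      exact pow_le_pow_left₀ (sq_nonneg _) (hψsq y) 2
    -- the weights that give the projection to the direction `Φ z₀ / ‖Φ z₀‖` variance `1`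
    set c : ι → ℝ := fun i => a i / √(s * σ) with hc
    have hc2 : (∑ i, c i ^ 2) * σ = 1 := by
      simp_rw [hc, div_pow, Real.sq_sqrt hsσ.le]
      rw [← Finset.sum_div, ← hsdef]
      field_simp
    have hc4 : (∑ i, c i ^ 4) * ∫ y, ψ y ^ 4 ∂P ≤ η₀ := by
      have h1 : ∑ i, c i ^ 4 = (∑ i, a i ^ 4) / (s * σ) ^ 2 := by
        rw [Finset.sum_div]
        refine Finset.sum_congr rfl fun i _ => ?_
        have h2 : √(s * σ) ^ 4 = (s * σ) ^ 2 := by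
          rw [show 4 = 2 * 2 by norm_num, pow_mul, Real.sq_sqrt hsσ.le]
        rw [hc, div_pow, h2]
      rw [h1, div_mul_eq_mul_div, div_le_iff₀ (by positivity)]
      calc (∑ i, a i ^ 4) * ∫ y, ψ y ^ 4 ∂P ≤ (∑ i, a i ^ 4) * Q := by gcongr
        _ ≤ η₀ * (r / 2) ^ 2 * (s * q) ^ 2 := hL.trans (by gcongr; exact min_le_right _ _)
        _ = η₀ * (s * (r * q / 2)) ^ 2 := by ring
        _ ≤ η₀ * (s * σ) ^ 2 := by gcongr
    refine (measureReal_mono fun w hw => ?_).trans (hsb P ψ c hψL hψ0 hc2 hc4)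
    simp only [Set.mem_ofPred_eq] at hw ⊢
    have hproj : (∑ i, a i * ψ (w i)) ^ 2 ≤ ‖∑ i, a i • Φ (w i)‖ ^ 2 := by
      have h1 : ∑ i, a i * ψ (w i) = ⟪Φ z₀, ∑ i, a i • Φ (w i)⟫_ℝ / √g := by
        rw [inner_sum, Finset.sum_div]
        refine Finset.sum_congr rfl fun i _ => ?_
        rw [inner_smul_right, hψ, mul_div_assoc]
      rw [h1, div_pow, Real.sq_sqrt hz0.le, div_le_iff₀ hz0, mul_comm]
      exact IsCenteredFeature.inner_sq_le _ _
    have hcs : ∑ i, c i * ψ (w i) = (∑ i, a i * ψ (w i)) / √(s * σ) := by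
      rw [Finset.sum_div]
      exact Finset.sum_congr rfl fun i _ => by rw [hc]; ring
    rw [← sq_le_sq₀ (abs_nonneg _) hρ.le, sq_abs, hcs, div_pow, Real.sq_sqrt hsσ.le,
      div_le_iff₀ hsσ]
    calc (∑ i, a i * ψ (w i)) ^ 2 ≤ ‖∑ i, a i • Φ (w i)‖ ^ 2 := hproj
      _ ≤ ρ ^ 2 * (r / 2) * (s * q) := hw.trans (by gcongr; exact min_le_right _ _)
      _ = ρ ^ 2 * (s * (r * q / 2)) := by ring
      _ ≤ ρ ^ 2 * (s * σ) := by gcongr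

end CrossMMD

/-! ### The studentized difference of two sample means -/

namespace CrossMMD

variable {𝒳 : Type*} [MeasurableSpace 𝒳] {P : Measure 𝒳}

/-- The difference of the means of two samples, divided by its estimated standard deviation. It is
`0` when the estimate vanishes. -/
noncomputable def studentizedDifference {n m : ℕ} (u : Fin n → ℝ) (v : Fin m → ℝ) : ℝ :=
  (sampleMean u - sampleMean v) /
    √(1 / (n : ℝ) * sampleVariance u + 1 / (m : ℝ) * sampleVariance v)

lemma sampleMean_add_const {N : ℕ} (hN : 0 < N) (u : Fin N → ℝ) (c : ℝ) :
    sampleMean (fun i => u i + c) = sampleMean u + c := by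
  have : (N : ℝ) ≠ 0 := by positivity
  simp only [sampleMean, Finset.sum_add_distrib, Finset.sum_const, Finset.card_univ,
    Fintype.card_fin, nsmul_eq_mul]
  field_simp

lemma sampleVariance_add_const {N : ℕ} (hN : 0 < N) (u : Fin N → ℝ) (c : ℝ) :
    sampleVariance (fun i => u i + c) = sampleVariance u := by
  simp only [sampleVariance, sampleMean_add_const hN, add_sub_add_right_eq_sub]

lemma studentizedDifference_add_const {n m : ℕ} (hn : 0 < n) (hm : 0 < m) (u : Fin n → ℝ)
    (v : Fin m → ℝ) (c : ℝ) :
    studentizedDifference (fun i => u i + c) (fun j => v j + c) = studentizedDifference u v := by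
  simp only [studentizedDifference, sampleMean_add_const hn, sampleMean_add_const hm,
    sampleVariance_add_const hn, sampleVariance_add_const hm, add_sub_add_right_eq_sub]

lemma sampleVariance_eq {N : ℕ} (hN : 0 < N) (u : Fin N → ℝ) :
    sampleVariance u = ∑ i, 1 / (N : ℝ) * u i ^ 2 - sampleMean u ^ 2 := by
  have hN' : (N : ℝ) ≠ 0 := by positivity
  have h1 : ∑ i, u i = N * sampleMean u := by
    rw [sampleMean]
    field_simp
  have h2 : ∀ i, (u i - sampleMean u) ^ 2 =
      u i ^ 2 - 2 * sampleMean u * u i + sampleMean u ^ 2 := fun i => by ring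
  rw [sampleVariance]
  simp_rw [h2]
  rw [Finset.sum_add_distrib, Finset.sum_sub_distrib, ← Finset.mul_sum, ← Finset.mul_sum, h1]
  simp only [Finset.sum_const, Finset.card_univ, Fintype.card_fin, nsmul_eq_mul]
  field_simp
  ring

lemma sampleMean_eq_sum {N : ℕ} (u : Fin N → ℝ) : sampleMean u = ∑ i, 1 / (N : ℝ) * u i := by
  rw [sampleMean, Finset.mul_sum]

lemma measurable_sampleMean {α : Type*} [MeasurableSpace α] {N : ℕ} {u : α → Fin N → ℝ}
    (hu : ∀ i, Measurable fun x => u x i) : Measurable fun x => sampleMean (u x) := by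
  simp only [sampleMean]
  fun_prop

lemma measurable_sampleVariance {α : Type*} [MeasurableSpace α] {N : ℕ} {u : α → Fin N → ℝ}
    (hu : ∀ i, Measurable fun x => u x i) : Measurable fun x => sampleVariance (u x) := by
  have := measurable_sampleMean hu
  simp only [sampleVariance]
  fun_prop

lemma measurable_studentizedDifference {α : Type*} [MeasurableSpace α] {n m : ℕ}
    {u : α → Fin n → ℝ} {v : α → Fin m → ℝ} (hu : ∀ i, Measurable fun x => u x i)
    (hv : ∀ i, Measurable fun x => v x i) :
    Measurable fun x => studentizedDifference (u x) (v x) := by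
  have h1 := measurable_sampleMean hu
  have h2 := measurable_sampleMean hv
  have h3 := measurable_sampleVariance hu
  have h4 := measurable_sampleVariance hv
  simp only [studentizedDifference]
  fun_prop

/-- The `L¹` consistency of the sample variance, with a rate. -/
lemma integral_abs_sampleVariance_sub_le [IsProbabilityMeasure P] {V : 𝒳 → ℝ} (hV : MemLp V 4 P)
    (h0 : ∫ x, V x ∂P = 0) {N : ℕ} (hN : 0 < N) :
    Integrable (fun z : Fin N → 𝒳 => |sampleVariance (fun i => V (z i)) - ∫ x, V x ^ 2 ∂P|)
      (Measure.pi fun _ => P) ∧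
    ∫ z : Fin N → 𝒳, |sampleVariance (fun i => V (z i)) - ∫ x, V x ^ 2 ∂P|
        ∂(Measure.pi fun _ => P) ≤
      √(1 / (N : ℝ) * ∫ x, V x ^ 4 ∂P) + 1 / (N : ℝ) * ∫ x, V x ^ 2 ∂P := by
  have hN' : (N : ℝ) ≠ 0 := by positivity
  set μ : Measure (Fin N → 𝒳) := Measure.pi fun _ => P
  set τ := ∫ x, V x ^ 2 ∂P with hτ
  set F := ∫ x, V x ^ 4 ∂P with hF
  have hV2 : MemLp (fun x => V x ^ 2) 2 P := by
    rw [memLp_two_iff_integrable_sq (f := fun x => V x ^ 2) (hV.1.pow 2)]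
    exact (integrable_pow_of_memLp_four hV le_rfl).congr (ae_of_all _ fun x => by ring)
  have hXL : ∀ _ : Fin N, MemLp (fun x => 1 / (N : ℝ) * V x ^ 2) 2 P := fun _ => hV2.const_mul _
  have hXLμ : ∀ i, MemLp (fun z : Fin N → 𝒳 => 1 / (N : ℝ) * V (z i) ^ 2) 2 μ := fun i =>
    (hXL i).comp_measurePreserving (measurePreserving_eval (fun _ : Fin N => P) i)
  set A : (Fin N → 𝒳) → ℝ := fun z => ∑ i, 1 / (N : ℝ) * V (z i) ^ 2 - τ with hA
  set B : (Fin N → 𝒳) → ℝ := fun z => sampleMean fun i => V (z i) with hB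
  obtain ⟨hM4, -, hM2, -⟩ := moments_weighted_sum hV h0 (fun _ : Fin N => 1 / (N : ℝ)) Finset.univ
  have hBL : MemLp B 4 μ := by
    simp only [hB, sampleMean_eq_sum]
    exact hM4
  have hB2 : ∫ z, B z ^ 2 ∂μ = 1 / (N : ℝ) * τ := by
    simp only [hB, sampleMean_eq_sum]
    rw [hM2]
    simp only [Finset.sum_const, Finset.card_univ, Fintype.card_fin, nsmul_eq_mul, ← hτ]
    field_simp
  have hAL : MemLp A 2 μ := (memLp_finsetSum _ fun i _ => hXLμ i).sub (memLp_const _)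
  have hmean : ∫ z, ∑ i, 1 / (N : ℝ) * V (z i) ^ 2 ∂μ = τ := by
    rw [integral_finsetSum _ fun i _ => (hXLμ i).integrable (by norm_num)]
    have h1 : ∀ i, ∫ z : Fin N → 𝒳, 1 / (N : ℝ) * V (z i) ^ 2 ∂μ = 1 / (N : ℝ) * τ := fun i => by
      rw [integral_const_mul]
      congr 1
      exact integral_comp_eval (μ := fun _ : Fin N => P) (i := i) (f := fun x => V x ^ 2)
        (hV.1.pow 2)
    simp only [h1, Finset.sum_const, Finset.card_univ, Fintype.card_fin, nsmul_eq_mul]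
    field_simp
  have hA2 : ∫ z, A z ^ 2 ∂μ ≤ 1 / (N : ℝ) * F := by
    have hv := variance_sum_pi (μ := fun _ : Fin N => P) hXL
    rw [variance_eq_integral (by
      exact (memLp_finsetSum' _ fun i _ => hXLμ i).1.aemeasurable)] at hv
    simp only [Finset.sum_apply] at hv
    change ∫ z, (∑ i, 1 / (N : ℝ) * V (z i) ^ 2 -
      ∫ z, ∑ i, 1 / (N : ℝ) * V (z i) ^ 2 ∂μ) ^ 2 ∂μ = _ at hv
    rw [hmean] at hv
    rw [hA, hv]
    have h1 : Var[fun x => 1 / (N : ℝ) * V x ^ 2; P] ≤ (1 / (N : ℝ)) ^ 2 * F := by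
      rw [variance_const_mul]
      gcongr
      refine (variance_le_expectation_sq hV2.1).trans (le_of_eq ?_)
      rw [hF]
      congr with x
      simp
      ring
    refine (Finset.sum_le_sum fun i _ => h1).trans (le_of_eq ?_)
    simp only [Finset.sum_const, Finset.card_univ, Fintype.card_fin, nsmul_eq_mul]
    field_simp
  have hAabs : ∫ z, |A z| ∂μ ≤ √(1 / (N : ℝ) * F) := by
    refine Real.le_sqrt_of_sq_le (le_trans ?_ hA2)
    have hvar := variance_nonneg (fun z => |A z|) μ
    have hAL' : MemLp (fun z => |A z|) 2 μ := hAL.abs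
    rw [variance_eq_sub hAL'] at hvar
    simp only [Pi.pow_apply, sq_abs] at hvar
    linarith
  have hB2I : Integrable (fun z => B z ^ 2) μ := integrable_pow_of_memLp_four hBL (by norm_num)
  have hAI : Integrable (fun z => |A z|) μ := (hAL.integrable (by norm_num)).abs
  have heq : ∀ z, sampleVariance (fun i => V (z i)) - τ = A z - B z ^ 2 := fun z => by
    rw [sampleVariance_eq hN]
    simp only [hA, hB]
    ring
  simp_rw [heq]
  refine ⟨((hAL.integrable (by norm_num)).sub hB2I).abs, ?_⟩
  calc ∫ z, |A z - B z ^ 2| ∂μ ≤ ∫ z, (|A z| + B z ^ 2) ∂μ := by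
        refine integral_mono ((hAL.integrable (by norm_num)).sub hB2I).abs (hAI.add hB2I)
          fun z => ?_
        refine (abs_sub _ _).trans (le_of_eq ?_)
        rw [abs_of_nonneg (sq_nonneg (B z))]
    _ = ∫ z, |A z| ∂μ + ∫ z, B z ^ 2 ∂μ := integral_add hAI hB2I
    _ ≤ _ := by rw [hB2]; gcongr

/-- The effect on the characteristic function of replacing the true standard deviation by an
estimated one; `R` is the ratio of the estimated to the true variance. -/
lemma norm_cexp_div_sqrt_sub_le (t T : ℝ) {R κ : ℝ} (hκ0 : 0 < κ) (hκ : κ ≤ 1 / 2) :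
    ‖Complex.exp ((t * (T / √R) : ℝ) * Complex.I) - Complex.exp ((t * T : ℝ) * Complex.I)‖ ≤
      2 * |R - 1| / κ + |t| * κ * (1 + T ^ 2) := by
  rcases le_or_gt |R - 1| κ with h | h
  · have hR : 1 / 2 ≤ R := by linarith [(abs_le.1 h).1]
    have hs : 1 / 2 ≤ √R := Real.le_sqrt_of_sq_le (by linarith)
    have h1 : |1 / √R - 1| ≤ κ := by
      have h2 : 1 / √R - 1 = -(R - 1) / (√R + R) := by
        have : R = √R ^ 2 := (Real.sq_sqrt (by linarith)).symm
        have h3 : √R + R ≠ 0 := by positivity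
        field_simp
        nlinarith
      rw [h2, abs_div, abs_neg, abs_of_pos (by positivity : 0 < √R + R)]
      exact (div_le_self (abs_nonneg _) (by linarith)).trans h
    have h2 : ‖Complex.exp ((t * (T / √R) : ℝ) * Complex.I) -
        Complex.exp ((t * T : ℝ) * Complex.I)‖ ≤ |t * (T / √R) - t * T| := by
      have h3 : Complex.exp ((t * (T / √R) : ℝ) * Complex.I) -
          Complex.exp ((t * T : ℝ) * Complex.I) = Complex.exp ((t * T : ℝ) * Complex.I) *
            (Complex.exp (Complex.I * (t * (T / √R) - t * T : ℝ)) - 1) := by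
        rw [mul_sub, ← Complex.exp_add, mul_one]
        congr 2
        push_cast
        ring
      rw [h3, norm_mul, Complex.norm_exp_ofReal_mul_I, one_mul]
      exact Real.norm_exp_I_mul_ofReal_sub_one_le
    have h3 : |t * (T / √R) - t * T| = |t| * |1 / √R - 1| * |T| := by
      rw [← abs_mul, ← abs_mul]
      congr 1
      ring
    have h4 : |T| ≤ 1 + T ^ 2 := by
      rw [← sq_abs]
      nlinarith [sq_nonneg (|T| - 1), abs_nonneg T]
    have h5 : 0 ≤ 2 * |R - 1| / κ := by positivity
    calc _ ≤ |t| * |1 / √R - 1| * |T| := h2.trans h3.le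
      _ ≤ |t| * κ * (1 + T ^ 2) := by gcongr
      _ ≤ _ := by linarith
  · have h1 : ‖Complex.exp ((t * (T / √R) : ℝ) * Complex.I) -
        Complex.exp ((t * T : ℝ) * Complex.I)‖ ≤ 2 := by
      refine (norm_sub_le _ _).trans (le_of_eq ?_)
      rw [Complex.norm_exp_ofReal_mul_I, Complex.norm_exp_ofReal_mul_I]
      norm_num
    have h2 : 2 ≤ 2 * |R - 1| / κ := by
      rw [le_div_iff₀ hκ0]
      linarith
    have h3 : 0 ≤ |t| * κ * (1 + T ^ 2) := by positivity
    linarith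

/-- A variable `T` of unit variance, divided by `√R` for some `R` close to `1` in `L¹`, has nearly
the same characteristic function as `T`. -/
lemma norm_charFun_div_sqrt_sub_le {Ω : Type*} [MeasurableSpace Ω] {ν : Measure Ω}
    [IsProbabilityMeasure ν] {T R : Ω → ℝ} (hTm : Measurable T) (hRm : Measurable R)
    (hTL : MemLp T 2 ν) (hT2 : ∫ z, T z ^ 2 ∂ν = 1) (hRI : Integrable (fun z => |R z - 1|) ν)
    {κ : ℝ} (hRE : ∫ z, |R z - 1| ∂ν ≤ 2 * κ ^ 2) (hκ0 : 0 < κ) (hκ : κ ≤ 1 / 2) (t : ℝ)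
    (hclt : ‖∫ z, Complex.exp ((t * T z : ℝ) * Complex.I) ∂ν - Complex.exp ((-(t ^ 2 / 2) : ℝ))‖ ≤
      (8 * |t| ^ 3 + t ^ 4) * κ ^ 2) :
    ‖∫ z, Complex.exp ((t * (T z / √(R z)) : ℝ) * Complex.I) ∂ν -
      Complex.exp ((-(t ^ 2 / 2) : ℝ))‖ ≤ (4 + 2 * |t| + (8 * |t| ^ 3 + t ^ 4)) * κ := by
  have hT2I : Integrable (fun z => 1 + T z ^ 2) ν := (integrable_const _).add hTL.integrable_sq
  have hexpI : ∀ Y : Ω → ℝ, Measurable Y →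
      Integrable (fun z => Complex.exp ((t * Y z : ℝ) * Complex.I)) ν := fun Y hY =>
    Integrable.of_bound (Measurable.aestronglyMeasurable (by fun_prop)) 1
      (ae_of_all _ fun z => (Complex.norm_exp_ofReal_mul_I _).le)
  have hmaj1 : Integrable (fun z => 2 * |R z - 1| / κ) ν := (hRI.const_mul 2).div_const κ
  have hmaj2 : Integrable (fun z => |t| * κ * (1 + T z ^ 2)) ν := hT2I.const_mul (|t| * κ)
  have hdiff : ‖∫ z, Complex.exp ((t * (T z / √(R z)) : ℝ) * Complex.I) ∂ν -
      ∫ z, Complex.exp ((t * T z : ℝ) * Complex.I) ∂ν‖ ≤ 4 * κ + 2 * |t| * κ := by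
    rw [← integral_sub (hexpI (fun z => T z / √(R z)) (by fun_prop)) (hexpI T hTm)]
    have hmaj : Integrable (fun z => 2 * |R z - 1| / κ + |t| * κ * (1 + T z ^ 2)) ν :=
      hmaj1.add hmaj2
    refine (norm_integral_le_of_norm_le hmaj (ae_of_all _ fun z =>
        norm_cexp_div_sqrt_sub_le t (T z) hκ0 hκ)).trans ?_
    rw [integral_add hmaj1 hmaj2, integral_div, integral_const_mul, integral_const_mul,
      integral_add (integrable_const _) hTL.integrable_sq, hT2]
    have h1 : 2 * ∫ z, |R z - 1| ∂ν ≤ 4 * κ * κ := by nlinarith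
    have h2 : 2 * (∫ z, |R z - 1| ∂ν) / κ ≤ 4 * κ := (div_le_iff₀ hκ0).2 h1
    simp only [integral_const, probReal_univ, smul_eq_mul, mul_one]
    linarith
  have hκ2 : κ ^ 2 ≤ κ := by nlinarith
  calc _ ≤ _ := norm_sub_le_norm_sub_add_norm_sub _
        (∫ z, Complex.exp ((t * T z : ℝ) * Complex.I) ∂ν) _
    _ ≤ (4 * κ + 2 * |t| * κ) + (8 * |t| ^ 3 + t ^ 4) * κ :=
        add_le_add hdiff (hclt.trans (by gcongr))
    _ = _ := by ring

lemma integral_abs_weighted_sub_le {Ω : Type*} [MeasurableSpace Ω] {ν : Measure Ω} {p r τ δ : ℝ}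
    (hp : 0 < p) (hr : 0 < r) (hτ : 0 < τ) {W₁ W₂ : Ω → ℝ}
    (hRm : Measurable fun z => (p * W₁ z + r * W₂ z) / ((p + r) * τ))
    (h₁ : Integrable (fun z => |W₁ z - τ|) ν) (h₂ : Integrable (fun z => |W₂ z - τ|) ν)
    (hE₁ : ∫ z, |W₁ z - τ| ∂ν ≤ δ * τ) (hE₂ : ∫ z, |W₂ z - τ| ∂ν ≤ δ * τ) :
    Integrable (fun z => |(p * W₁ z + r * W₂ z) / ((p + r) * τ) - 1|) ν ∧
      ∫ z, |(p * W₁ z + r * W₂ z) / ((p + r) * τ) - 1| ∂ν ≤ δ := by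
  have hbτ : 0 < (p + r) * τ := by positivity
  have hRabs : ∀ z, |(p * W₁ z + r * W₂ z) / ((p + r) * τ) - 1| ≤
      (p * |W₁ z - τ| + r * |W₂ z - τ|) / ((p + r) * τ) := fun z => by
    have h1 : (p * W₁ z + r * W₂ z) / ((p + r) * τ) - 1 =
        (p * (W₁ z - τ) + r * (W₂ z - τ)) / ((p + r) * τ) := by
      field_simp
      ring
    rw [h1, abs_div, abs_of_pos hbτ]
    gcongr
    refine (abs_add_le _ _).trans (le_of_eq ?_)
    rw [abs_mul, abs_mul, abs_of_pos hp, abs_of_pos hr]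
  have hmajI : Integrable (fun z => (p * |W₁ z - τ| + r * |W₂ z - τ|) / ((p + r) * τ)) ν :=
    ((h₁.const_mul p).add (h₂.const_mul r)).div_const _
  have hRI : Integrable (fun z => |(p * W₁ z + r * W₂ z) / ((p + r) * τ) - 1|) ν := by
    refine hmajI.mono' ?_ (ae_of_all _ fun z => by rw [Real.norm_eq_abs, abs_abs]; exact hRabs z)
    exact (continuous_abs.measurable.comp (hRm.sub_const 1)).aestronglyMeasurable
  refine ⟨hRI, (integral_mono hRI hmajI hRabs).trans ?_⟩
  rw [integral_div, integral_add (h₁.const_mul p) (h₂.const_mul r), integral_const_mul,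
    integral_const_mul, div_le_iff₀ hbτ]
  calc _ ≤ p * (δ * τ) + r * (δ * τ) := by gcongr
    _ = _ := by ring

/-- Quantitative central limit theorem for the studentized difference of the means of two i.i.d.
samples from the same distribution. With a Lyapunov ratio of order `κ ^ 4`, the deviation from
normality of the normalized difference and the relative error of the variance estimate are both of
order `κ ^ 2`; cutting off the latter at `κ` leaves a bound of order `κ`. -/
lemma norm_charFun_studentizedDifference_sub_le [IsProbabilityMeasure P] {V : 𝒳 → ℝ}
    (hVm : Measurable V) (hV : MemLp V 4 P) (h0 : ∫ x, V x ∂P = 0) (hτ : 0 < ∫ x, V x ^ 2 ∂P)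
    {n m : ℕ} (hn : 0 < n) (hm : 0 < m) {κ : ℝ} (hκ0 : 0 < κ) (hκ : κ ≤ 1 / 2)
    (hL : (1 / (n : ℝ) + 1 / (m : ℝ)) * ∫ x, V x ^ 4 ∂P ≤ κ ^ 4 * (∫ x, V x ^ 2 ∂P) ^ 2)
    (t : ℝ) :
    ‖∫ z : Fin n ⊕ Fin m → 𝒳, Complex.exp ((t * studentizedDifference (fun i => V (z (.inl i)))
        (fun j => V (z (.inr j))) : ℝ) * Complex.I) ∂(Measure.pi fun _ => P) -
      Complex.exp ((-(t ^ 2 / 2) : ℝ))‖ ≤ (4 + 2 * |t| + (8 * |t| ^ 3 + t ^ 4)) * κ := by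
  set μ : Measure (Fin n ⊕ Fin m → 𝒳) := Measure.pi fun _ => P
  set τ := ∫ x, V x ^ 2 ∂P with hτdef
  set F := ∫ x, V x ^ 4 ∂P with hF
  have hFτ : τ ^ 2 ≤ F := sq_integral_sq_le hV
  set p : ℝ := 1 / (n : ℝ) with hp
  set r : ℝ := 1 / (m : ℝ) with hr
  have hp0 : 0 < p := by positivity
  have hr0 : 0 < r := by positivity
  set b : ℝ := p + r with hb
  have hb0 : 0 < b := by positivity
  have hbτ : 0 < b * τ := mul_pos hb0 hτ
  have hsqrt : 0 < √(b * τ) := Real.sqrt_pos.2 hbτ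
  -- the difference of the means, normalized by its true standard deviation
  set c : Fin n ⊕ Fin m → ℝ := Sum.elim (fun _ => p / √(b * τ)) (fun _ => -(r / √(b * τ))) with hc
  set T : (Fin n ⊕ Fin m → 𝒳) → ℝ := fun z => ∑ i, c i * V (z i) with hT
  set W₁ : (Fin n ⊕ Fin m → 𝒳) → ℝ := fun z => sampleVariance fun i => V (z (.inl i)) with hW₁
  set W₂ : (Fin n ⊕ Fin m → 𝒳) → ℝ := fun z => sampleVariance fun j => V (z (.inr j)) with hW₂
  set R : (Fin n ⊕ Fin m → 𝒳) → ℝ := fun z => (p * W₁ z + r * W₂ z) / (b * τ) with hR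
  have hnp : (n : ℝ) * p = 1 := by rw [hp]; field_simp
  have hmr : (m : ℝ) * r = 1 := by rw [hr]; field_simp
  have hs2 : √(b * τ) ^ 2 = b * τ := Real.sq_sqrt hbτ.le
  have hc2 : (∑ i, c i ^ 2) * τ = 1 := by
    simp only [hc, Fintype.sum_sum_type, Sum.elim_inl, Sum.elim_inr, Finset.sum_const,
      Finset.card_univ, Fintype.card_fin, nsmul_eq_mul, neg_sq, div_pow, hs2]
    have h1 : (n : ℝ) * (p ^ 2 / (b * τ)) + m * (r ^ 2 / (b * τ)) =
        ((n * p) * p + (m * r) * r) / (b * τ) := by ring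
    rw [h1, hnp, hmr, one_mul, one_mul, ← hb]
    field_simp
  have hL' : b * F / τ ^ 2 ≤ κ ^ 4 := (div_le_iff₀ (by positivity)).2 hL
  have hc4 : (∑ i, c i ^ 4) * F ≤ (κ ^ 2) ^ 2 := by
    have hs4 : √(b * τ) ^ 4 = (b * τ) ^ 2 := by
      rw [show 4 = 2 * 2 by norm_num, pow_mul, hs2]
    have hneg : ∀ x : ℝ, (-x) ^ 4 = x ^ 4 := fun x => by ring
    simp only [hc, Fintype.sum_sum_type, Sum.elim_inl, Sum.elim_inr, Finset.sum_const,
      Finset.card_univ, Fintype.card_fin, nsmul_eq_mul, hneg, div_pow, hs4]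
    have h1 : (n : ℝ) * (p ^ 4 / (b * τ) ^ 2) + m * (r ^ 4 / (b * τ) ^ 2) =
        ((n * p) * p ^ 3 + (m * r) * r ^ 3) / (b * τ) ^ 2 := by ring
    rw [h1, hnp, hmr, one_mul, one_mul]
    have h2 : p ^ 3 + r ^ 3 ≤ b ^ 3 := by
      rw [hb]
      have : 0 ≤ 3 * p * r * (p + r) := by positivity
      nlinarith
    have hF0 : 0 ≤ F := (sq_nonneg _).trans hFτ
    calc (p ^ 3 + r ^ 3) / (b * τ) ^ 2 * F ≤ b ^ 3 / (b * τ) ^ 2 * F := by gcongr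
      _ = b * F / τ ^ 2 := by field_simp
      _ ≤ κ ^ 4 := hL'
      _ = (κ ^ 2) ^ 2 := by ring
  have hclt := norm_charFun_weighted_sum_sub_le' hV h0 c hc2 (d := κ ^ 2) (by positivity)
    (by nlinarith) hc4 t
  obtain ⟨hTL, -, hT2, -⟩ := moments_weighted_sum hV h0 c Finset.univ
  rw [hc2] at hT2
  have hstat : ∀ z, studentizedDifference (fun i => V (z (.inl i))) (fun j => V (z (.inr j))) =
      T z / √(R z) := fun z => by
    have h1 : T z = (sampleMean (fun i => V (z (.inl i))) - sampleMean fun j => V (z (.inr j))) /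
        √(b * τ) := by
      simp only [hT, hc, Fintype.sum_sum_type, Sum.elim_inl, Sum.elim_inr, sampleMean,
        ← Finset.mul_sum, hp, hr]
      ring
    rw [h1, hR, studentizedDifference, Real.sqrt_div' _ hbτ.le, div_div_eq_mul_div,
      div_mul_cancel₀ _ hsqrt.ne']
  have hRm : Measurable R := by
    have h1 : Measurable W₁ := measurable_sampleVariance fun i => by fun_prop
    have h2 : Measurable W₂ := measurable_sampleVariance fun i => by fun_prop
    fun_prop
  have hTm : Measurable T := by fun_prop
  -- the two halves of the sample
  have hpres := measurePreserving_sumPiEquivProdPi (fun _ : Fin n ⊕ Fin m => P)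
  have hfst : MeasurePreserving (fun (z : Fin n ⊕ Fin m → 𝒳) (i : Fin n) => z (.inl i)) μ
      (Measure.pi fun _ => P) := measurePreserving_fst.comp hpres
  have hsnd : MeasurePreserving (fun (z : Fin n ⊕ Fin m → 𝒳) (j : Fin m) => z (.inr j)) μ
      (Measure.pi fun _ => P) := measurePreserving_snd.comp hpres
  obtain ⟨hI₁, hE₁⟩ := integral_abs_sampleVariance_sub_le hV h0 hn
  obtain ⟨hI₂, hE₂⟩ := integral_abs_sampleVariance_sub_le hV h0 hm
  have hI₁' : Integrable (fun z => |W₁ z - τ|) μ := hfst.integrable_comp_of_integrable hI₁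
  have hI₂' : Integrable (fun z => |W₂ z - τ|) μ := hsnd.integrable_comp_of_integrable hI₂
  have hE₁' : ∫ z, |W₁ z - τ| ∂μ ≤ √(b * F) + b * τ := by
    rw [← hfst.map_eq, integral_map hfst.measurable.aemeasurable
      (by rw [hfst.map_eq]; exact hI₁.1)] at hE₁
    refine hE₁.trans ?_
    have : p ≤ b := by linarith
    gcongr
  have hE₂' : ∫ z, |W₂ z - τ| ∂μ ≤ √(b * F) + b * τ := by
    rw [← hsnd.map_eq, integral_map hsnd.measurable.aemeasurable
      (by rw [hsnd.map_eq]; exact hI₂.1)] at hE₂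
    refine hE₂.trans ?_
    have : r ≤ b := by linarith
    gcongr
  have hκb : b ≤ κ ^ 2 := by
    have h1 : b * τ ^ 2 ≤ κ ^ 4 * τ ^ 2 := (mul_le_mul_of_nonneg_left hFτ hb0.le).trans hL
    have h2 : b ≤ κ ^ 4 := le_of_mul_le_mul_right h1 (by positivity)
    exact h2.trans (pow_le_pow_of_le_one hκ0.le (by linarith) (by norm_num))
  have hE : √(b * F) + b * τ ≤ 2 * κ ^ 2 * τ := by
    have h1 : √(b * F) ≤ κ ^ 2 * τ := by
      rw [Real.sqrt_le_left (by positivity)]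
      exact hL.trans (le_of_eq (by ring))
    have h2 : b * τ ≤ κ ^ 2 * τ := mul_le_mul_of_nonneg_right hκb hτ.le
    linarith
  obtain ⟨hRI, hRE⟩ := integral_abs_weighted_sub_le hp0 hr0 hτ hRm hI₁' hI₂' (hE₁'.trans hE)
    (hE₂'.trans hE)
  simp_rw [hstat]
  exact norm_charFun_div_sqrt_sub_le hTm hRm (hTL.mono_exponent (by norm_num)) hT2 hRI hRE hκ0 hκ t
    hclt

end CrossMMD

/-! ### The cross statistic of a degenerate kernel -/

namespace CrossMMD

variable {𝒳 : Type*} [MeasurableSpace 𝒳] {P : Measure 𝒳} {ι : Type*}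

/-- A symmetric kernel that is degenerate with respect to `P`, that is, centred in each of its
arguments, and has finite fourth moments, jointly and for every fixed value of one argument. -/
structure IsDegenerateKernel (P : Measure 𝒳) (κ : 𝒳 → 𝒳 → ℝ) : Prop where
  measurable : Measurable fun z : 𝒳 × 𝒳 => κ z.1 z.2
  symm : ∀ x y, κ x y = κ y x
  memLp : ∀ x, MemLp (κ x) 4 P
  integral_eq_zero : ∀ x, ∫ y, κ x y ∂P = 0
  integrable_pow : Integrable (fun z : 𝒳 × 𝒳 => κ z.1 z.2 ^ 4) (P.prod P)

/-- The linear combination `∑ aᵢ κ(wᵢ, ·)`. -/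
def kernelSum [Fintype ι] (κ : 𝒳 → 𝒳 → ℝ) (a : ι → ℝ) (w : ι → 𝒳) (x : 𝒳) : ℝ :=
  ∑ i, a i * κ (w i) x

namespace IsDegenerateKernel

variable {κ : 𝒳 → 𝒳 → ℝ}

lemma memLp_two [IsProbabilityMeasure P] (h : IsDegenerateKernel P κ) (x : 𝒳) :
    MemLp (κ x) 2 P :=
  (h.memLp x).mono_exponent (by norm_num)

/-- The section `κ(x, ·)` as an element of `L²(P)`. -/
noncomputable def feature [IsProbabilityMeasure P] (h : IsDegenerateKernel P κ) (x : 𝒳) :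
    Lp ℝ 2 P :=
  (h.memLp_two x).toLp (κ x)

lemma inner_feature [IsProbabilityMeasure P] (h : IsDegenerateKernel P κ) (x y : 𝒳) :
    ⟪h.feature x, h.feature y⟫_ℝ = ∫ z, κ x z * κ y z ∂P := by
  rw [L2.inner_def]
  refine integral_congr_ae ?_
  filter_upwards [(h.memLp_two x).coeFn_toLp, (h.memLp_two y).coeFn_toLp] with z hx hy
  rw [feature, feature, hx, hy]
  simp [mul_comm]

lemma norm_sq_feature [IsProbabilityMeasure P] (h : IsDegenerateKernel P κ) (x : 𝒳) :
    ‖h.feature x‖ ^ 2 = ∫ z, κ x z ^ 2 ∂P := by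
  rw [← real_inner_self_eq_norm_sq, h.inner_feature]
  simp_rw [sq]

lemma memLp_prod [IsFiniteMeasure P] (h : IsDegenerateKernel P κ) :
    MemLp (fun z : 𝒳 × 𝒳 => κ z.1 z.2) 4 (P.prod P) := by
  rw [← integrable_norm_rpow_iff h.measurable.aestronglyMeasurable (by norm_num) (by norm_num)]
  refine h.integrable_pow.congr (ae_of_all _ fun z => ?_)
  have h4 : ((4 : ENNReal).toReal) = ((4 : ℕ) : ℝ) := by norm_num
  simp only
  rw [h4, Real.rpow_natCast, Real.norm_eq_abs, ← abs_pow, abs_of_nonneg (by positivity)]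

lemma integrable_sq [IsProbabilityMeasure P] (h : IsDegenerateKernel P κ) :
    Integrable (fun z : 𝒳 × 𝒳 => κ z.1 z.2 ^ 2) (P.prod P) :=
  integrable_pow_of_memLp_four h.memLp_prod (by norm_num)

lemma norm_pow_four_feature_le [IsProbabilityMeasure P] (h : IsDegenerateKernel P κ) (x : 𝒳) :
    ‖h.feature x‖ ^ 4 ≤ ∫ z, κ x z ^ 4 ∂P := by
  have : ‖h.feature x‖ ^ 4 = (‖h.feature x‖ ^ 2) ^ 2 := by ring
  rw [this, h.norm_sq_feature]
  exact sq_integral_sq_le (h.memLp x)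

/-- The inner products of the sections `κ(x, ·)` form the kernel of the square of the integral
operator of `κ`; it inherits the degeneracy of `κ` by Fubini's theorem. -/
lemma isCenteredFeature [IsProbabilityMeasure P] (h : IsDegenerateKernel P κ) :
    IsCenteredFeature P h.feature := by
  have hmeas : Measurable fun z : 𝒳 × 𝒳 => ⟪h.feature z.1, h.feature z.2⟫_ℝ := by
    simp_rw [h.inner_feature]
    have h1 : Measurable fun p : (𝒳 × 𝒳) × 𝒳 => κ p.1.1 p.2 :=
      h.measurable.comp (g := fun z : 𝒳 × 𝒳 => κ z.1 z.2)
        (f := fun p : (𝒳 × 𝒳) × 𝒳 => (p.1.1, p.2)) (by fun_prop)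
    have h2 : Measurable fun p : (𝒳 × 𝒳) × 𝒳 => κ p.1.2 p.2 :=
      h.measurable.comp (g := fun z : 𝒳 × 𝒳 => κ z.1 z.2)
        (f := fun p : (𝒳 × 𝒳) × 𝒳 => (p.1.2, p.2)) (by fun_prop)
    exact ((h1.mul h2).stronglyMeasurable.integral_prod_right' (ν := P)).measurable
  refine ⟨hmeas, fun x => ?_, ?_⟩
  · simp_rw [h.inner_feature]
    have h1 : MemLp (fun p : 𝒳 × 𝒳 => κ x p.2) 2 (P.prod P) :=
      (h.memLp_two x).comp_measurePreserving measurePreserving_snd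
    have h2 : MemLp (fun p : 𝒳 × 𝒳 => κ p.1 p.2) 2 (P.prod P) :=
      h.memLp_prod.mono_exponent (by norm_num)
    rw [integral_integral_swap (h1.integrable_mul h2)]
    have h3 : ∀ z, ∫ y, κ x z * κ y z ∂P = 0 := fun z => by
      rw [integral_const_mul]
      simp_rw [fun y => h.symm y z]
      rw [h.integral_eq_zero, mul_zero]
    simp [h3]
  · refine h.integrable_pow.integral_prod_left.mono' ?_ (ae_of_all _ fun x => ?_)
    · have h1 : Measurable fun x => ‖h.feature x‖ ^ 2 := by
        simpa [Function.comp_def, real_inner_self_eq_norm_sq] using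
          hmeas.comp (measurable_id.prodMk measurable_id)
      have h2 : Measurable fun x => (‖h.feature x‖ ^ 2) ^ 2 := h1.pow_const 2
      simp_rw [← pow_mul] at h2
      exact h2.aestronglyMeasurable
    · rw [Real.norm_eq_abs, abs_of_nonneg (by positivity)]
      exact h.norm_pow_four_feature_le x

lemma integral_norm_sq_feature [IsProbabilityMeasure P] (h : IsDegenerateKernel P κ) :
    ∫ x, ‖h.feature x‖ ^ 2 ∂P = ∫ z, κ z.1 z.2 ^ 2 ∂(P.prod P) := by
  rw [integral_prod _ h.integrable_sq]
  simp_rw [h.norm_sq_feature]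

lemma integral_norm_pow_four_feature_le [IsProbabilityMeasure P] (h : IsDegenerateKernel P κ) :
    ∫ x, ‖h.feature x‖ ^ 4 ∂P ≤ ∫ z, κ z.1 z.2 ^ 4 ∂(P.prod P) := by
  rw [integral_prod _ h.integrable_pow]
  exact integral_mono h.isCenteredFeature.integrable_norm_pow h.integrable_pow.integral_prod_left
    h.norm_pow_four_feature_le

section
variable [Fintype ι]

lemma measurable_kernelSum (h : IsDegenerateKernel P κ) (a : ι → ℝ) :
    Measurable fun p : (ι → 𝒳) × 𝒳 => kernelSum κ a p.1 p.2 := by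
  refine Finset.measurable_fun_sum _ fun i _ => Measurable.const_mul ?_ _
  exact h.measurable.comp (g := fun z : 𝒳 × 𝒳 => κ z.1 z.2)
    (f := fun p : (ι → 𝒳) × 𝒳 => (p.1 i, p.2)) (by fun_prop)

lemma memLp_kernelSum (h : IsDegenerateKernel P κ) (a : ι → ℝ) (w : ι → 𝒳) :
    MemLp (kernelSum κ a w) 4 P :=
  memLp_finsetSum _ fun i _ => (h.memLp (w i)).const_mul (a i)

lemma integral_kernelSum [IsProbabilityMeasure P] (h : IsDegenerateKernel P κ) (a : ι → ℝ)
    (w : ι → 𝒳) : ∫ x, kernelSum κ a w x ∂P = 0 := by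
  simp only [kernelSum]
  rw [integral_finsetSum _ fun i _ => ((h.memLp_two (w i)).integrable (by norm_num)).const_mul _]
  simp_rw [integral_const_mul, h.integral_eq_zero]
  simp

lemma integral_kernelSum_sq [IsProbabilityMeasure P] (h : IsDegenerateKernel P κ) (a : ι → ℝ)
    (w : ι → 𝒳) : ∫ x, kernelSum κ a w x ^ 2 ∂P = ‖∑ i, a i • h.feature (w i)‖ ^ 2 := by
  rw [← real_inner_self_eq_norm_sq, sum_inner]
  simp_rw [inner_sum, inner_smul_left, inner_smul_right, h.inner_feature]
  have h1 : ∀ x, kernelSum κ a w x ^ 2 =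
      ∑ i, ∑ j, a i * (a j * (κ (w i) x * κ (w j) x)) := fun x => by
    rw [kernelSum, sq, Finset.sum_mul_sum]
    exact Finset.sum_congr rfl fun i _ => Finset.sum_congr rfl fun j _ => by ring
  have hI : ∀ i j, Integrable (fun x => a i * (a j * (κ (w i) x * κ (w j) x))) P := fun i j =>
    (((h.memLp_two (w i)).integrable_mul (h.memLp_two (w j))).const_mul _).const_mul _
  simp_rw [h1]
  rw [integral_finsetSum _ fun i _ => integrable_finsetSum _ fun j _ => hI i j]
  refine Finset.sum_congr rfl fun i _ => ?_
  rw [integral_finsetSum _ fun j _ => hI i j]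
  refine Finset.sum_congr rfl fun j _ => ?_
  rw [integral_const_mul, integral_const_mul]
  simp

lemma measurable_integral_kernelSum_pow [IsProbabilityMeasure P] (h : IsDegenerateKernel P κ)
    (a : ι → ℝ) (p : ℕ) : Measurable fun w => ∫ x, kernelSum κ a w x ^ p ∂P :=
  (((h.measurable_kernelSum a).pow_const p).stronglyMeasurable.integral_prod_right'
    (ν := P)).measurable

/-- The fourth moment of `∑ aᵢ κ(wᵢ, ·)`, averaged over the i.i.d. sample `w`. -/
lemma integral_kernelSum_pow_four_le [IsProbabilityMeasure P] (h : IsDegenerateKernel P κ)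
    (a : ι → ℝ) :
    Integrable (fun w : ι → 𝒳 => ∫ x, kernelSum κ a w x ^ 4 ∂P) (Measure.pi fun _ => P) ∧
    ∫ w : ι → 𝒳, ∫ x, kernelSum κ a w x ^ 4 ∂P ∂(Measure.pi fun _ => P) ≤
      3 * (∑ i, a i ^ 2) ^ 2 * ∫ z, κ z.1 z.2 ^ 4 ∂(P.prod P) := by
  have hL : MemLp (fun p : (ι → 𝒳) × 𝒳 => kernelSum κ a p.1 p.2) 4
      ((Measure.pi fun _ => P).prod P) := by
    refine memLp_finsetSum _ fun i _ => MemLp.const_mul ?_ _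
    exact h.memLp_prod.comp_measurePreserving
      ((measurePreserving_eval (fun _ : ι => P) i).prod (MeasurePreserving.id P))
  have hI := integrable_pow_of_memLp_four hL le_rfl
  refine ⟨hI.integral_prod_left, ?_⟩
  rw [integral_integral_swap hI, integral_prod _ h.integrable_pow, ← integral_const_mul]
  refine integral_mono hI.integral_prod_right (h.integrable_pow.integral_prod_left.const_mul _)
    fun x => ?_
  have h1 := (moments_weighted_sum (h.memLp x) (h.integral_eq_zero x) a Finset.univ).2.2.2
  simp only [kernelSum]
  simp_rw [fun y => h.symm y x]
  exact h1

end

end IsDegenerateKernel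

/-- The weights `1 / n` and `-1 / m` of the difference of two sample means. -/
noncomputable def contrast (n m : ℕ) : Fin n ⊕ Fin m → ℝ :=
  Sum.elim (fun _ => 1 / (n : ℝ)) fun _ => -(1 / (m : ℝ))

lemma sum_contrast_sq {n m : ℕ} (hn : 0 < n) (hm : 0 < m) :
    ∑ i, contrast n m i ^ 2 = 1 / (n : ℝ) + 1 / (m : ℝ) := by
  simp only [contrast, Fintype.sum_sum_type, Sum.elim_inl, Sum.elim_inr, Finset.sum_const,
    Finset.card_univ, Fintype.card_fin, nsmul_eq_mul]
  field_simp

lemma sum_contrast_pow_four_le {n m : ℕ} (hn : 0 < n) (hm : 0 < m) :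
    ∑ i, contrast n m i ^ 4 ≤ (1 / (n : ℝ) + 1 / (m : ℝ)) ^ 3 := by
  have hn' : (0 : ℝ) < n := by exact_mod_cast hn
  have hm' : (0 : ℝ) < m := by exact_mod_cast hm
  have h1 : ∑ i, contrast n m i ^ 4 = (1 / (n : ℝ)) ^ 3 + (1 / (m : ℝ)) ^ 3 := by
    simp only [contrast, Fintype.sum_sum_type, Sum.elim_inl, Sum.elim_inr, Finset.sum_const,
      Finset.card_univ, Fintype.card_fin, nsmul_eq_mul]
    field_simp
  rw [h1]
  have h2 : 0 < 1 / (n : ℝ) := by positivity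
  have h3 : 0 < 1 / (m : ℝ) := by positivity
  have : 0 ≤ 3 * (1 / (n : ℝ)) * (1 / (m : ℝ)) * (1 / (n : ℝ) + 1 / (m : ℝ)) := by positivity
  nlinarith

/-- The studentized cross statistic of a kernel `κ`; `w` is the sample that defines the witness
function `∑ aᵢ κ(wᵢ, ·)`, and `z` the sample on which this function is evaluated. -/
noncomputable def crossStatistic (κ : 𝒳 → 𝒳 → ℝ) {n₁ m₁ n₂ m₂ : ℕ} (w : Fin n₂ ⊕ Fin m₂ → 𝒳)
    (z : Fin n₁ ⊕ Fin m₁ → 𝒳) : ℝ :=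
  studentizedDifference (fun i => kernelSum κ (contrast n₂ m₂) w (z (.inl i)))
    fun j => kernelSum κ (contrast n₂ m₂) w (z (.inr j))

lemma IsDegenerateKernel.measurable_crossStatistic {κ : 𝒳 → 𝒳 → ℝ} (h : IsDegenerateKernel P κ)
    (n₁ m₁ n₂ m₂ : ℕ) : Measurable fun p : (Fin n₂ ⊕ Fin m₂ → 𝒳) × (Fin n₁ ⊕ Fin m₁ → 𝒳) =>
      crossStatistic κ p.1 p.2 := by
  have h1 : ∀ i, Measurable fun p : (Fin n₂ ⊕ Fin m₂ → 𝒳) × (Fin n₁ ⊕ Fin m₁ → 𝒳) =>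
      kernelSum κ (contrast n₂ m₂) p.1 (p.2 i) := fun i =>
    (h.measurable_kernelSum (contrast n₂ m₂)).comp
      (f := fun p : (Fin n₂ ⊕ Fin m₂ → 𝒳) × (Fin n₁ ⊕ Fin m₁ → 𝒳) => (p.1, p.2 i)) (by fun_prop)
  exact measurable_studentizedDifference (fun i => h1 (.inl i)) fun j => h1 (.inr j)

/-- The central limit theorem for the cross statistic, uniformly over all degenerate kernels: the
characteristic function is close to the Gaussian one once the normalized fourth moment of the kernel
is small compared with the sample sizes. Conditionally on the sample `w` the statistic is a
studentized difference of i.i.d. means, and the conditional Lyapunov ratio is controlled by the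
average of the fourth moment and the lower tail of the second moment of the witness function. -/
lemma exists_norm_charFun_crossStatistic_sub_le (t : ℝ) {ε : ℝ} (hε : 0 < ε) :
    ∃ η > 0, ∀ (P : Measure 𝒳) [IsProbabilityMeasure P] (κ : 𝒳 → 𝒳 → ℝ) (n₁ m₁ n₂ m₂ : ℕ),
      IsDegenerateKernel P κ → 0 < n₁ → 0 < m₁ → 0 < n₂ → 0 < m₂ →
      0 < ∫ z, κ z.1 z.2 ^ 2 ∂(P.prod P) →
      (1 / (n₁ : ℝ) + 1 / (m₁ : ℝ)) * ∫ z, κ z.1 z.2 ^ 4 ∂(P.prod P) ≤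
        η * (∫ z, κ z.1 z.2 ^ 2 ∂(P.prod P)) ^ 2 →
      (1 / (n₂ : ℝ) + 1 / (m₂ : ℝ)) * ∫ z, κ z.1 z.2 ^ 4 ∂(P.prod P) ≤
        η * (∫ z, κ z.1 z.2 ^ 2 ∂(P.prod P)) ^ 2 →
      ‖∫ p : (Fin n₂ ⊕ Fin m₂ → 𝒳) × (Fin n₁ ⊕ Fin m₁ → 𝒳),
          Complex.exp ((t * crossStatistic κ p.1 p.2 : ℝ) * Complex.I)
          ∂((Measure.pi fun _ => P).prod (Measure.pi fun _ => P)) -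
        Complex.exp ((-(t ^ 2 / 2) : ℝ))‖ ≤ ε := by
  obtain ⟨δ, hδ, η₀, hη₀, htail⟩ :=
    exists_measureReal_norm_sq_le (𝒳 := 𝒳) (ε := ε / 8) (by positivity)
  set C := 4 + 2 * |t| + (8 * |t| ^ 3 + t ^ 4) with hC
  have hC0 : 0 < C := by positivity
  set θ := min (1 / 2) (ε / 2 / C) with hθ
  have hθ0 : 0 < θ := by positivity
  have hCθ : C * θ ≤ ε / 2 := by
    calc C * θ ≤ C * (ε / 2 / C) := by gcongr; exact min_le_right _ _
      _ = ε / 2 := by field_simp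
  refine ⟨min η₀ (θ ^ 4 * δ ^ 2 * ε / 24), by positivity, ?_⟩
  intro P _ κ n₁ m₁ n₂ m₂ h hn₁ hm₁ hn₂ hm₂ hq hL₁ hL₂
  set q := ∫ z, κ z.1 z.2 ^ 2 ∂(P.prod P) with hqdef
  set Q := ∫ z, κ z.1 z.2 ^ 4 ∂(P.prod P) with hQdef
  have hQ0 : 0 ≤ Q := integral_nonneg fun z => by positivity
  set a := contrast n₂ m₂
  set s := ∑ i, a i ^ 2 with hsdef
  have hs : s = 1 / (n₂ : ℝ) + 1 / (m₂ : ℝ) := sum_contrast_sq hn₂ hm₂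
  have hs0 : 0 < s := by rw [hs]; positivity
  set b := 1 / (n₁ : ℝ) + 1 / (m₁ : ℝ) with hb
  have hb0 : 0 < b := by positivity
  rw [← hs] at hL₂
  set μw : Measure (Fin n₂ ⊕ Fin m₂ → 𝒳) := Measure.pi fun _ => P
  set μz : Measure (Fin n₁ ⊕ Fin m₁ → 𝒳) := Measure.pi fun _ => P
  -- the second and the fourth moment of the witness function
  set τ : (Fin n₂ ⊕ Fin m₂ → 𝒳) → ℝ := fun w => ∫ x, kernelSum κ a w x ^ 2 ∂P with hτ
  set F : (Fin n₂ ⊕ Fin m₂ → 𝒳) → ℝ := fun w => ∫ x, kernelSum κ a w x ^ 4 ∂P with hF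
  have hF0 : ∀ w, 0 ≤ F w := fun w => integral_nonneg fun x => by positivity
  -- the samples `w` with an exceptionally small second or an exceptionally large fourth moment
  set B₁ : Set (Fin n₂ ⊕ Fin m₂ → 𝒳) := {w | τ w ≤ δ * (s * q)} with hB₁
  set B₂ : Set (Fin n₂ ⊕ Fin m₂ → 𝒳) := {w | 24 * s ^ 2 * Q ≤ ε * F w ∧ 0 < F w} with hB₂
  have hmτ : Measurable τ := h.measurable_integral_kernelSum_pow a 2
  have hmF : Measurable F := h.measurable_integral_kernelSum_pow a 4
  have hB₁m : MeasurableSet B₁ := measurableSet_le hmτ measurable_const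
  have hB₂m : MeasurableSet B₂ :=
    (measurableSet_le measurable_const (hmF.const_mul ε)).inter
      (measurableSet_lt measurable_const hmF)
  have hP₁ : μw.real B₁ ≤ ε / 8 := by
    have h1 := htail P h.feature a h.isCenteredFeature hs0
      (by rw [h.integral_norm_sq_feature]; exact hq) ?_
    · rw [h.integral_norm_sq_feature] at h1
      simp_rw [← h.integral_kernelSum_sq] at h1
      exact h1
    · rw [h.integral_norm_sq_feature]
      have h2 : ∑ i, a i ^ 4 ≤ s ^ 3 := by
        rw [hs]
        exact sum_contrast_pow_four_le hn₂ hm₂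
      calc _ ≤ s ^ 3 * Q := by
            gcongr
            exact h.integral_norm_pow_four_feature_le
        _ = s ^ 2 * (s * Q) := by ring
        _ ≤ s ^ 2 * (η₀ * q ^ 2) :=
            mul_le_mul_of_nonneg_left (hL₂.trans (by gcongr; exact min_le_left _ _)) (sq_nonneg s)
        _ = _ := by ring
  have hP₂ : μw.real B₂ ≤ ε / 8 := by
    obtain ⟨hFI, hFE⟩ := h.integral_kernelSum_pow_four_le a
    rcases hQ0.eq_or_lt with hQ | hQ
    · -- here the fourth moment vanishes almost surely
      have h1 : ∫ w, F w ∂μw = 0 := by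
        refine le_antisymm ?_ (integral_nonneg hF0)
        refine hFE.trans (le_of_eq ?_)
        rw [← hQdef, ← hQ, mul_zero]
      have h2 : F =ᵐ[μw] 0 := (integral_eq_zero_iff_of_nonneg hF0 hFI).1 h1
      have h3 : μw.real B₂ = 0 := by
        rw [measureReal_def, show μw B₂ = 0 from ?_, ENNReal.toReal_zero]
        refine measure_mono_null (fun w hw => ?_) h2
        exact ne_of_gt hw.2
      rw [h3]
      positivity
    · have h1 := mul_meas_ge_le_integral_of_nonneg (ae_of_all _ hF0) hFI (24 * s ^ 2 * Q / ε)
      have h2 : μw.real B₂ ≤ μw.real {w | 24 * s ^ 2 * Q / ε ≤ F w} := by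
        refine measureReal_mono fun w hw => ?_
        have h4 := hw.1
        simp only [Set.mem_ofPred_eq]
        rw [div_le_iff₀ hε]
        linarith
      have h3 : 24 * s ^ 2 * Q / ε * μw.real B₂ ≤ 3 * s ^ 2 * Q :=
        (mul_le_mul_of_nonneg_left h2 (by positivity)).trans (h1.trans hFE)
      have h4 : 24 * s ^ 2 * Q / ε * μw.real B₂ ≤ 24 * s ^ 2 * Q / ε * (ε / 8) := by
        refine h3.trans (le_of_eq ?_)
        field_simp
        norm_num
      exact le_of_mul_le_mul_left h4 (by positivity)
  have hmeas := h.measurable_crossStatistic n₁ m₁ n₂ m₂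
  have hexp : Integrable (fun p : (Fin n₂ ⊕ Fin m₂ → 𝒳) × (Fin n₁ ⊕ Fin m₁ → 𝒳) =>
      Complex.exp ((t * crossStatistic κ p.1 p.2 : ℝ) * Complex.I)) (μw.prod μz) :=
    Integrable.of_bound (Measurable.aestronglyMeasurable (by fun_prop)) 1
      (ae_of_all _ fun z => (Complex.norm_exp_ofReal_mul_I _).le)
  rw [integral_prod _ hexp]
  set g : (Fin n₂ ⊕ Fin m₂ → 𝒳) → ℂ := fun w =>
    ∫ z, Complex.exp ((t * crossStatistic κ w z : ℝ) * Complex.I) ∂μz with hg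
  set G : ℂ := Complex.exp ((-(t ^ 2 / 2) : ℝ)) with hG
  have hgood : ∀ w, w ∉ B₁ ∪ B₂ → ‖g w - G‖ ≤ ε / 2 := by
    intro w hw
    rw [Set.mem_union, not_or] at hw
    have hw1 : δ * (s * q) < τ w := not_le.1 hw.1
    have hτ0 : 0 < τ w := lt_trans (by positivity) hw1
    have hFw : 0 < F w :=
      lt_of_lt_of_le (by positivity) (sq_integral_sq_le (h.memLp_kernelSum a w))
    have hw2 : ε * F w < 24 * s ^ 2 * Q := not_le.1 fun hc => hw.2 ⟨hc, hFw⟩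
    have hm : Measurable (kernelSum κ a w) :=
      (h.measurable_kernelSum a).comp measurable_prodMk_left
    refine (norm_charFun_studentizedDifference_sub_le hm (h.memLp_kernelSum a w)
      (h.integral_kernelSum a w) hτ0 hn₁ hm₁ hθ0 (min_le_left _ _) ?_ t).trans hCθ
    change b * F w ≤ θ ^ 4 * τ w ^ 2
    have h1 : b * Q ≤ θ ^ 4 * δ ^ 2 * ε / 24 * q ^ 2 :=
      hL₁.trans (by gcongr; exact min_le_right _ _)
    have h2 : ε * (b * F w) ≤ ε * (θ ^ 4 * τ w ^ 2) := by
      calc ε * (b * F w) = b * (ε * F w) := by ring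
        _ ≤ b * (24 * s ^ 2 * Q) := by gcongr
        _ = 24 * s ^ 2 * (b * Q) := by ring
        _ ≤ 24 * s ^ 2 * (θ ^ 4 * δ ^ 2 * ε / 24 * q ^ 2) := by gcongr
        _ = ε * (θ ^ 4 * (δ * (s * q)) ^ 2) := by ring
        _ ≤ ε * (θ ^ 4 * τ w ^ 2) := by gcongr
    exact le_of_mul_le_mul_left h2 hε
  have hG1 : ‖G‖ ≤ 1 := by
    rw [hG, ← Complex.ofReal_exp, Complex.norm_real, Real.norm_eq_abs, Real.abs_exp,
      Real.exp_le_one_iff, neg_nonpos]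
    positivity
  have hg1 : ∀ w, ‖g w‖ ≤ 1 := fun w =>
    (norm_integral_le_of_norm_le_const (C := 1)
      (ae_of_all _ fun z => (Complex.norm_exp_ofReal_mul_I _).le)).trans (by simp)
  have hBm : MeasurableSet (B₁ ∪ B₂) := hB₁m.union hB₂m
  have hindI : Integrable ((B₁ ∪ B₂).indicator fun _ => (2 : ℝ)) μw :=
    (integrable_const _).indicator hBm
  have hgI : Integrable g μw := hexp.integral_prod_left
  have hsub : ∫ w, g w ∂μw - G = ∫ w, (g w - G) ∂μw := by
    rw [integral_sub hgI (integrable_const _)]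
    simp
  change ‖∫ w, g w ∂μw - G‖ ≤ ε
  have hmaj : Integrable (fun w => ε / 2 + (B₁ ∪ B₂).indicator (fun _ => (2 : ℝ)) w) μw :=
    (integrable_const _).add hindI
  rw [hsub]
  refine (norm_integral_le_of_norm_le hmaj (ae_of_all _ fun w => ?_)).trans ?_
  · by_cases hw : w ∈ B₁ ∪ B₂
    · rw [Set.indicator_of_mem hw]
      have := (norm_sub_le (g w) G).trans (add_le_add (hg1 w) hG1)
      linarith
    · rw [Set.indicator_of_notMem hw, add_zero]
      exact hgood w hw
  · rw [integral_add (integrable_const _) hindI, integral_indicator_const _ hBm]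
    have := measureReal_union_le (μ := μw) B₁ B₂
    simp only [integral_const, probReal_univ, smul_eq_mul, one_mul]
    linarith

end CrossMMD

/-! ### The cross-MMD as the cross statistic of the centred kernel -/

namespace CrossMMD

variable {𝒳 : Type*} [MeasurableSpace 𝒳] {P : Measure 𝒳}

section Kernel

variable {α : Type*} (k : PDKernel α)

lemma feature_inner_feature (x y : α) : ⟪k.feature x, k.feature y⟫_ℝ = k x y := by
  rw [k.inner_feature, k.feature_apply]

lemma centered_eq (μ : k.Space) (x y : α) :
    k.centered μ x y = k x y - μ x - μ y + ⟪μ, μ⟫_ℝ := by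
  rw [PDKernel.centered, inner_sub_left, inner_sub_right, inner_sub_right, feature_inner_feature,
    real_inner_comm μ (k.feature x), k.inner_feature, k.inner_feature]
  ring

lemma centered_symm (μ : k.Space) (x y : α) : k.centered μ x y = k.centered μ y x :=
  real_inner_comm _ _

lemma inner_feature_empiricalEmbedding {N : ℕ} (z : α) (x : Fin N → α) :
    ⟪k.feature z, k.empiricalEmbedding x⟫_ℝ = 1 / (N : ℝ) * ∑ i, k z (x i) := by
  rw [PDKernel.empiricalEmbedding, inner_smul_right, inner_sum, one_div]
  simp_rw [feature_inner_feature]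

lemma crossMMDSq_eq {n₁ n₂ m₁ m₂ : ℕ} (hn₁ : 0 < n₁) (hn₂ : 0 < n₂) (hm₁ : 0 < m₁) (hm₂ : 0 < m₂)
    (x₁ : Fin n₁ → α) (x₂ : Fin n₂ → α) (y₁ : Fin m₁ → α) (y₂ : Fin m₂ → α) :
    k.crossMMDSq x₁ x₂ y₁ y₂ =
      sampleMean (fun i => ⟪k.feature (x₁ i),
        k.empiricalEmbedding x₂ - k.empiricalEmbedding y₂⟫_ℝ) -
      sampleMean fun j => ⟪k.feature (y₁ j),
        k.empiricalEmbedding x₂ - k.empiricalEmbedding y₂⟫_ℝ := by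
  have h1 : (n₁ : ℝ) ≠ 0 := by positivity
  have h2 : (n₂ : ℝ) ≠ 0 := by positivity
  have h3 : (m₁ : ℝ) ≠ 0 := by positivity
  have h4 : (m₂ : ℝ) ≠ 0 := by positivity
  simp only [PDKernel.crossMMDSq, PDKernel.h, sampleMean, inner_sub_right,
    inner_feature_empiricalEmbedding, Finset.sum_add_distrib, Finset.sum_sub_distrib,
    Finset.sum_const, Finset.card_univ, Fintype.card_fin, nsmul_eq_mul, ← Finset.mul_sum]
  rw [Finset.sum_comm (γ := Fin n₂) (f := fun i j => k (y₁ j) (x₂ i))]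
  field_simp
  ring

lemma kernelSum_centered_add {n m : ℕ} (hn : 0 < n) (hm : 0 < m) (μ : k.Space) (x : Fin n → α)
    (y : Fin m → α) (z : α) :
    kernelSum (k.centered μ) (contrast n m) (Sum.elim x y) z +
        ⟪μ, k.empiricalEmbedding x - k.empiricalEmbedding y⟫_ℝ =
      ⟪k.feature z, k.empiricalEmbedding x - k.empiricalEmbedding y⟫_ℝ := by
  have h1 : (n : ℝ) ≠ 0 := by positivity
  have h2 : (m : ℝ) ≠ 0 := by positivity
  have h3 : ∀ {N : ℕ} (x : Fin N → α),
      ⟪μ, k.empiricalEmbedding x⟫_ℝ = 1 / (N : ℝ) * ∑ i, μ (x i) := fun {N} x => by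
    rw [PDKernel.empiricalEmbedding, inner_smul_right, inner_sum, one_div]
    simp_rw [k.inner_feature]
  have hs : ∀ a b, k a b = k b a := fun a b => by
    rw [← feature_inner_feature, ← feature_inner_feature, real_inner_comm]
  simp only [kernelSum, contrast, Fintype.sum_sum_type, Sum.elim_inl, Sum.elim_inr, centered_eq,
    inner_sub_right, inner_feature_empiricalEmbedding, h3, ← Finset.mul_sum,
    Finset.sum_add_distrib, Finset.sum_sub_distrib, Finset.sum_const, Finset.card_univ,
    Fintype.card_fin, nsmul_eq_mul, neg_mul, Finset.sum_neg_distrib]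
  simp_rw [fun a => hs a z]
  field_simp
  ring

/-- The statistic depends on the kernel only through the centred kernel: the weights of the witness
function add up to `0`, and adding a constant to both samples does not change a studentized
difference. -/
lemma studentizedCrossMMD_eq {n m : ℕ} (hn : 2 ≤ n) (hm : 2 ≤ m) (μ : k.Space) (x : Fin n → α)
    (y : Fin m → α) :
    k.studentizedCrossMMD x y = crossStatistic (k.centered μ)
      (Sum.elim (secondHalf x) (secondHalf y)) (Sum.elim (firstHalf x) (firstHalf y)) := by
  have hn₁ : 0 < n / 2 := by omega
  have hm₁ : 0 < m / 2 := by omega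
  have hn₂ : 0 < n - n / 2 := by omega
  have hm₂ : 0 < m - m / 2 := by omega
  rw [crossStatistic, ← studentizedDifference_add_const hn₁ hm₁ _ _
    ⟪μ, k.empiricalEmbedding (secondHalf x) - k.empiricalEmbedding (secondHalf y)⟫_ℝ]
  simp_rw [kernelSum_centered_add k hn₂ hm₂]
  rw [PDKernel.studentizedCrossMMD, crossMMDSq_eq k hn₁ hn₂ hm₁ hm₂]
  rfl

end Kernel

lemma measurable_studentizedCrossMMD (k : PDKernel 𝒳)
    (hk : Measurable fun z : 𝒳 × 𝒳 => k z.1 z.2) (n m : ℕ) :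
    Measurable fun p : (Fin n → 𝒳) × (Fin m → 𝒳) => k.studentizedCrossMMD p.1 p.2 := by
  have hx : ∀ i : Fin n, Measurable fun p : (Fin n → 𝒳) × (Fin m → 𝒳) => p.1 i :=
    fun i => (measurable_pi_apply i).comp measurable_fst
  have hy : ∀ j : Fin m, Measurable fun p : (Fin n → 𝒳) × (Fin m → 𝒳) => p.2 j :=
    fun j => (measurable_pi_apply j).comp measurable_snd
  have hkk : ∀ {f g : (Fin n → 𝒳) × (Fin m → 𝒳) → 𝒳}, Measurable f → Measurable g →
      Measurable fun p => k (f p) (g p) := fun hf hg => hk.comp (hf.prodMk hg)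
  have hU : ∀ {f : (Fin n → 𝒳) × (Fin m → 𝒳) → 𝒳}, Measurable f → Measurable fun p =>
      ⟪k.feature (f p), k.empiricalEmbedding (secondHalf p.1) -
        k.empiricalEmbedding (secondHalf p.2)⟫_ℝ := fun hf => by
    simp only [inner_sub_right, inner_feature_empiricalEmbedding]
    exact ((Finset.measurable_fun_sum _ fun i _ => hkk hf (hx _)).const_mul _).sub
      ((Finset.measurable_fun_sum _ fun i _ => hkk hf (hy _)).const_mul _)
  have hnum : Measurable fun p : (Fin n → 𝒳) × (Fin m → 𝒳) =>
      k.crossMMDSq (firstHalf p.1) (secondHalf p.1) (firstHalf p.2) (secondHalf p.2) := by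
    refine Measurable.const_mul ?_ _
    refine Finset.measurable_fun_sum _ fun i _ => Finset.measurable_fun_sum _ fun i' _ =>
      Finset.measurable_fun_sum _ fun j _ => Finset.measurable_fun_sum _ fun j' _ => ?_
    exact (((hkk (hx _) (hx _)).sub (hkk (hx _) (hy _))).sub (hkk (hy _) (hx _))).add
      (hkk (hy _) (hy _))
  have hden : Measurable fun p : (Fin n → 𝒳) × (Fin m → 𝒳) =>
      k.crossVariance (firstHalf p.1) (secondHalf p.1) (firstHalf p.2) (secondHalf p.2) :=
    ((measurable_sampleVariance fun i => hU (hx _)).const_mul _).add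
      ((measurable_sampleVariance fun i => hU (hy _)).const_mul _)
  exact hnum.div hden.sqrt

section Centered

variable [IsProbabilityMeasure P] {k : PDKernel 𝒳} {μ : k.Space}

lemma measurable_centered (hk : Measurable fun z : 𝒳 × 𝒳 => k z.1 z.2)
    (hμ : k.IsMeanEmbedding P μ) : Measurable fun z : 𝒳 × 𝒳 => k.centered μ z.1 z.2 := by
  -- the values of the mean embedding are integrals of the kernel, hence measurable
  have h1 : ∀ x, μ x = ∫ y, k x y ∂P := fun x => by
    rw [← k.inner_feature, real_inner_comm, ← (hμ (k.feature x)).2]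
    simp_rw [k.feature_apply]
  have h2 : Measurable fun x => μ x := by
    simp_rw [h1]
    exact (hk.stronglyMeasurable.integral_prod_right' (ν := P)).measurable
  simp_rw [centered_eq]
  exact ((hk.sub (h2.comp measurable_fst)).sub (h2.comp measurable_snd)).add_const _

lemma integral_centered (hμ : k.IsMeanEmbedding P μ) (x : 𝒳) :
    ∫ y, k.centered μ x y ∂P = 0 := by
  have h1 : ∀ y, k.centered μ x y = (k.feature x - μ) y - ⟪k.feature x - μ, μ⟫_ℝ := fun y => by
    rw [PDKernel.centered, inner_sub_right, k.inner_feature]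
  simp_rw [h1]
  rw [integral_sub (hμ _).1 (integrable_const _), (hμ _).2]
  simp

end Centered

/-- A centred kernel with a finite joint fourth moment agrees, off a null set of points, with a
kernel all of whose sections have a finite fourth moment. -/
lemma exists_isDegenerateKernel [IsProbabilityMeasure P] {κ : 𝒳 → 𝒳 → ℝ}
    (hm : Measurable fun z : 𝒳 × 𝒳 => κ z.1 z.2) (hs : ∀ x y, κ x y = κ y x)
    (h0 : ∀ x, ∫ y, κ x y ∂P = 0)
    (hI : Integrable (fun z : 𝒳 × 𝒳 => κ z.1 z.2 ^ 4) (P.prod P)) :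
    ∃ (κ' : 𝒳 → 𝒳 → ℝ) (G : Set 𝒳), IsDegenerateKernel P κ' ∧ (∀ᵐ x ∂P, x ∈ G) ∧
      ∀ x ∈ G, ∀ y ∈ G, κ' x y = κ x y := by
  classical
  set G : Set 𝒳 := {x | ∫⁻ y, ‖κ x y ^ 4‖ₑ ∂P < ⊤} with hG
  have hmx : ∀ x, Measurable (κ x) := fun x => hm.comp measurable_prodMk_left
  have hGm : MeasurableSet G := by
    have : Measurable fun x => ∫⁻ y, ‖κ x y ^ 4‖ₑ ∂P :=
      Measurable.lintegral_prod_right' (f := fun z : 𝒳 × 𝒳 => ‖κ z.1 z.2 ^ 4‖ₑ)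
        (hm.pow_const 4).enorm
    exact measurableSet_lt this measurable_const
  have hGae : ∀ᵐ x ∂P, x ∈ G := by
    filter_upwards [hI.prod_right_ae] with x hx
    exact hx.2
  set κ' : 𝒳 → 𝒳 → ℝ := fun x y => if x ∈ G ∧ y ∈ G then κ x y else 0 with hκ'
  have heq : ∀ x ∈ G, ∀ y ∈ G, κ' x y = κ x y := fun x hx y hy => if_pos ⟨hx, hy⟩
  have hm' : Measurable fun z : 𝒳 × 𝒳 => κ' z.1 z.2 :=
    Measurable.ite (hGm.prod hGm) hm measurable_const
  have hzero : ∀ x, x ∉ G → κ' x = 0 := fun x hx => by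
    ext y
    exact if_neg fun h => hx h.1
  have hae : ∀ x ∈ G, κ' x =ᵐ[P] κ x := fun x hx => by
    filter_upwards [hGae] with y hy using heq x hx y hy
  refine ⟨κ', G, ⟨hm', fun x y => ?_, fun x => ?_, fun x => ?_, ?_⟩, hGae, heq⟩
  · simp only [hκ', hs x y, and_comm]
  · by_cases hx : x ∈ G
    · refine (MemLp.ae_eq (hae x hx).symm) ?_
      rw [← integrable_norm_rpow_iff (hmx x).aestronglyMeasurable (by norm_num) (by norm_num)]
      have h4 : ((4 : ENNReal).toReal) = ((4 : ℕ) : ℝ) := by norm_num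
      have h1 : Integrable (fun y => κ x y ^ 4) P :=
        ⟨((hmx x).pow_const 4).aestronglyMeasurable, hx⟩
      refine h1.congr (ae_of_all _ fun y => ?_)
      simp only
      rw [h4, Real.rpow_natCast, Real.norm_eq_abs, ← abs_pow, abs_of_nonneg (by positivity)]
    · rw [hzero x hx]
      exact MemLp.zero
  · by_cases hx : x ∈ G
    · rw [integral_congr_ae (hae x hx), h0]
    · simp [hzero x hx]
  · refine hI.mono (hm'.pow_const 4).aestronglyMeasurable (ae_of_all _ fun z => ?_)
    simp only [hκ']
    split_ifs <;> simp

/-- The law of the split samples: the sample points of the second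
halves and those of the first halves form two independent i.i.d. families. -/
lemma map_split_eq [IsProbabilityMeasure P] {Ω : Type*} [MeasurableSpace Ω] {ν : Measure Ω}
    [IsProbabilityMeasure ν] {n m : ℕ} {X : Fin n → Ω → 𝒳} {Y : Fin m → Ω → 𝒳}
    (hX : ∀ i, HasLaw (X i) P ν) (hY : ∀ j, HasLaw (Y j) P ν)
    (hind : iIndepFun (Sum.elim X Y) ν) :
    AEMeasurable (fun ω => ((Sum.elim (secondHalf fun i => X i ω) (secondHalf fun j => Y j ω),
      Sum.elim (firstHalf fun i => X i ω) (firstHalf fun j => Y j ω)) :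
      (Fin (n - n / 2) ⊕ Fin (m - m / 2) → 𝒳) × (Fin (n / 2) ⊕ Fin (m / 2) → 𝒳))) ν ∧
    ν.map (fun ω => ((Sum.elim (secondHalf fun i => X i ω) (secondHalf fun j => Y j ω),
      Sum.elim (firstHalf fun i => X i ω) (firstHalf fun j => Y j ω)) :
      (Fin (n - n / 2) ⊕ Fin (m - m / 2) → 𝒳) × (Fin (n / 2) ⊕ Fin (m / 2) → 𝒳))) =
      (Measure.pi fun _ => P).prod (Measure.pi fun _ => P) := by
  -- the positions in the two samples that the split points come from
  set σ : (Fin (n - n / 2) ⊕ Fin (m - m / 2)) ⊕ (Fin (n / 2) ⊕ Fin (m / 2)) → Fin n ⊕ Fin m :=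
    Sum.elim (Sum.map (fun i => ⟨n / 2 + i, by omega⟩) (fun j => ⟨m / 2 + j, by omega⟩))
      (Sum.map (fun i => ⟨i, by omega⟩) (fun j => ⟨j, by omega⟩)) with hσ
  have hσinj : Function.Injective σ := by
    rintro ((i | i) | (i | i)) ((j | j) | (j | j)) h <;>
      simp [hσ, Fin.ext_iff] at h ⊢ <;> omega
  have hlaw : ∀ i, HasLaw (Sum.elim X Y i) P ν := by
    rintro (i | j)
    · exact hX i
    · exact hY j
  have haem : ∀ i, AEMeasurable (Sum.elim X Y (σ i)) ν := fun i => (hlaw _).aemeasurable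
  have hmap := (hind.precomp hσinj).map_fun_eq_pi_map haem
  simp only [(hlaw _).map_eq] at hmap
  have hpres := measurePreserving_sumPiEquivProdPi (fun _ :
    (Fin (n - n / 2) ⊕ Fin (m - m / 2)) ⊕ (Fin (n / 2) ⊕ Fin (m / 2)) => P)
  have hjoint : AEMeasurable (fun ω i => Sum.elim X Y (σ i) ω) ν := aemeasurable_pi_lambda _ haem
  have hfun : (fun ω => ((Sum.elim (secondHalf fun i => X i ω) (secondHalf fun j => Y j ω),
      Sum.elim (firstHalf fun i => X i ω) (firstHalf fun j => Y j ω)) :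
      (Fin (n - n / 2) ⊕ Fin (m - m / 2) → 𝒳) × (Fin (n / 2) ⊕ Fin (m / 2) → 𝒳))) =
      MeasurableEquiv.sumPiEquivProdPi (fun _ => 𝒳) ∘ fun ω i => Sum.elim X Y (σ i) ω := by
    ext ω i
    · rcases i with i | i <;> rfl
    · rcases i with i | i <;> rfl
  rw [hfun]
  refine ⟨(MeasurableEquiv.measurable _).comp_aemeasurable hjoint, ?_⟩
  rw [← AEMeasurable.map_map_of_aemeasurable (MeasurableEquiv.measurable _).aemeasurable hjoint,
    hmap, hpres.map_eq]

/-- If two kernels agree on a set of full measure, then the cross statistics agree almost surely. -/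
lemma crossStatistic_ae_eq [IsProbabilityMeasure P] {κ κ' : 𝒳 → 𝒳 → ℝ} {G : Set 𝒳}
    (hG : ∀ᵐ x ∂P, x ∈ G) (h : ∀ x ∈ G, ∀ y ∈ G, κ' x y = κ x y) (n₁ m₁ n₂ m₂ : ℕ) :
    ∀ᵐ p : (Fin n₂ ⊕ Fin m₂ → 𝒳) × (Fin n₁ ⊕ Fin m₁ → 𝒳)
      ∂((Measure.pi fun _ => P).prod (Measure.pi fun _ => P)),
      crossStatistic κ' p.1 p.2 = crossStatistic κ p.1 p.2 := by
  have hpi : ∀ {ι : Type} [Fintype ι], ∀ᵐ w : ι → 𝒳 ∂(Measure.pi fun _ => P), ∀ i, w i ∈ G :=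
    fun {ι} _ => ae_all_iff.2 fun i => (Measure.quasiMeasurePreserving_eval _ i).ae hG
  have h1 := Measure.quasiMeasurePreserving_fst (μ := (Measure.pi fun _ : Fin n₂ ⊕ Fin m₂ => P))
    (ν := (Measure.pi fun _ : Fin n₁ ⊕ Fin m₁ => P)) |>.ae hpi
  have h2 := Measure.quasiMeasurePreserving_snd (μ := (Measure.pi fun _ : Fin n₂ ⊕ Fin m₂ => P))
    (ν := (Measure.pi fun _ : Fin n₁ ⊕ Fin m₁ => P)) |>.ae hpi
  filter_upwards [h1, h2] with p hp1 hp2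
  have h3 : ∀ i, kernelSum κ' (contrast n₂ m₂) p.1 (p.2 i) =
      kernelSum κ (contrast n₂ m₂) p.1 (p.2 i) := fun i =>
    Finset.sum_congr rfl fun j _ => by rw [h _ (hp1 j) _ (hp2 i)]
  simp only [crossStatistic, h3]

lemma one_div_half_add_le {n m : ℕ} (hn : 2 ≤ n) (hm : 2 ≤ m) :
    1 / ((n / 2 : ℕ) : ℝ) + 1 / ((m / 2 : ℕ) : ℝ) ≤ 3 * (1 / (n : ℝ) + 1 / (m : ℝ)) ∧
    1 / ((n - n / 2 : ℕ) : ℝ) + 1 / ((m - m / 2 : ℕ) : ℝ) ≤ 3 * (1 / (n : ℝ) + 1 / (m : ℝ)) := by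
  have key : ∀ {a b : ℕ}, 0 < a → b ≤ 3 * a → 0 < b → 1 / (a : ℝ) ≤ 3 * (1 / (b : ℝ)) := by
    intro a b ha hab hb
    rw [mul_one_div, div_le_div_iff₀ (by positivity) (by positivity), one_mul]
    exact_mod_cast hab
  have h1 := key (a := n / 2) (b := n) (by omega) (by omega) (by omega)
  have h2 := key (a := m / 2) (b := m) (by omega) (by omega) (by omega)
  have h3 := key (a := n - n / 2) (b := n) (by omega) (by omega) (by omega)
  have h4 := key (a := m - m / 2) (b := m) (by omega) (by omega) (by omega)
  constructor <;> linarith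

end CrossMMD

theorem mainTheorem1 {𝒳 : Type*} [MeasurableSpace 𝒳]
    (P : Measure 𝒳) [IsProbabilityMeasure P]
    -- the second sample size `m = m n`
    (m : ℕ → ℕ) (hm_mono : Monotone m) (hm : Tendsto m atTop atTop)
    -- measurable positive definite kernels, with the mean embeddings of `P`
    (k : ℕ → PDKernel 𝒳) (hk : ∀ n, Measurable (fun z : 𝒳 × 𝒳 => k n z.1 z.2))
    (μ : ∀ n, (k n).Space) (hμ : ∀ n, (k n).IsMeanEmbedding P (μ n))
    -- the moment condition on the centered kernels, its quotient being well defined for large `n`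
    (h_fin : ∀ᶠ n in atTop,
      Integrable (fun z : 𝒳 × 𝒳 => (k n).centered (μ n) z.1 z.2 ^ 4) (P.prod P))
    (h_pos : ∀ᶠ n in atTop, 0 < ∫ z, (k n).centered (μ n) z.1 z.2 ^ 2 ∂(P.prod P))
    (h_moment : Tendsto (fun n : ℕ =>
      (∫ z, (k n).centered (μ n) z.1 z.2 ^ 4 ∂(P.prod P)) /
        (∫ z, (k n).centered (μ n) z.1 z.2 ^ 2 ∂(P.prod P)) ^ 2 *
          (1 / (n : ℝ) + 1 / (m n : ℝ))) atTop (𝓝 0))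
    -- the eigenvalue condition
    (h_eig : ∃ ρ : ℝ, Tendsto (fun n : ℕ =>
      kernelEigenvalue ((k n).centered (μ n)) P 0 ^ 2 /
        ∑' l : ℕ, kernelEigenvalue ((k n).centered (μ n)) P l ^ 2) atTop (𝓝 ρ))
    -- for every `n`, two independent i.i.d. samples of sizes `n` and `m n`, both drawn from `P`
    {Ω : ℕ → Type*} [∀ n, MeasurableSpace (Ω n)]
    (Pr : ∀ n, Measure (Ω n)) [∀ n, IsProbabilityMeasure (Pr n)]
    (X : ∀ n, Fin n → Ω n → 𝒳) (Y : ∀ n, Fin (m n) → Ω n → 𝒳)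
    (hX : ∀ n i, HasLaw (X n i) P (Pr n)) (hY : ∀ n j, HasLaw (Y n j) P (Pr n))
    (h_indep : ∀ n, iIndepFun (Sum.elim (X n) (Y n)) (Pr n)) :
    TendstoInDistribution
      (fun n ω => (k n).studentizedCrossMMD (fun i => X n i ω) (fun j => Y n j ω))
      atTop (id : ℝ → ℝ) Pr (gaussianReal 0 1) := by
  have hae : ∀ n, AEMeasurable
      (fun ω => (k n).studentizedCrossMMD (fun i => X n i ω) (fun j => Y n j ω)) (Pr n) := fun n =>
    (CrossMMD.measurable_studentizedCrossMMD (k n) (hk n) n (m n)).comp_aemeasurable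
      (f := fun ω => ((fun i => X n i ω), fun j => Y n j ω))
      ((aemeasurable_pi_lambda _ fun i => (hX n i).aemeasurable).prodMk
        (aemeasurable_pi_lambda _ fun j => (hY n j).aemeasurable))
  refine ⟨hae, aemeasurable_id, ?_⟩
  refine ProbabilityMeasure.tendsto_iff_tendsto_charFun.2 fun t => ?_
  change Tendsto (fun n => charFun ((Pr n).map fun ω =>
    (k n).studentizedCrossMMD (fun i => X n i ω) (fun j => Y n j ω)) t) atTop
    (𝓝 (charFun ((gaussianReal 0 1).map id) t))
  rw [Measure.map_id]
  have hgauss : charFun (gaussianReal 0 1) t = Complex.exp ((-(t ^ 2 / 2) : ℝ)) := by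
    rw [charFun_gaussianReal]
    congr 1
    push_cast
    ring
  rw [hgauss, Metric.tendsto_nhds]
  intro ε hε
  obtain ⟨η, hη, hmain⟩ :=
    CrossMMD.exists_norm_charFun_crossStatistic_sub_le (𝒳 := 𝒳) t (half_pos hε)
  filter_upwards [h_fin, h_pos, h_moment.eventually_lt_const (by positivity : 0 < η / 3),
    eventually_ge_atTop 2, hm.eventually_ge_atTop 2] with n hfin hpos hmom hn hmn
  obtain ⟨κ, G, hκ, hG, hκG⟩ := CrossMMD.exists_isDegenerateKernel
    (CrossMMD.measurable_centered (hk n) (hμ n)) (CrossMMD.centered_symm (k n) (μ n))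
    (CrossMMD.integral_centered (hμ n)) hfin
  have hprod : ∀ᵐ z ∂(P.prod P), κ z.1 z.2 = (k n).centered (μ n) z.1 z.2 := by
    filter_upwards [Measure.quasiMeasurePreserving_fst.ae hG,
      Measure.quasiMeasurePreserving_snd.ae hG] with z h1 h2 using hκG _ h1 _ h2
  have hpow : ∀ p : ℕ, ∫ z, κ z.1 z.2 ^ p ∂(P.prod P) =
      ∫ z, (k n).centered (μ n) z.1 z.2 ^ p ∂(P.prod P) := fun p =>
    integral_congr_ae (by filter_upwards [hprod] with z hz using by rw [hz])
  set q := ∫ z, (k n).centered (μ n) z.1 z.2 ^ 2 ∂(P.prod P)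
  set Q := ∫ z, (k n).centered (μ n) z.1 z.2 ^ 4 ∂(P.prod P)
  have hQ0 : 0 ≤ Q := integral_nonneg fun z => by positivity
  have hmom' : 3 * (1 / (n : ℝ) + 1 / (m n : ℝ)) * Q ≤ η * q ^ 2 := by
    have h1 : 3 * (1 / (n : ℝ) + 1 / (m n : ℝ)) * Q =
        3 * (Q / q ^ 2 * (1 / (n : ℝ) + 1 / (m n : ℝ))) * q ^ 2 := by
      have : q ≠ 0 := hpos.ne'
      field_simp
    rw [h1]
    gcongr
    linarith
  obtain ⟨hb₁, hb₂⟩ := CrossMMD.one_div_half_add_le hn hmn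
  have hfinal := hmain P κ (n / 2) (m n / 2) (n - n / 2) (m n - m n / 2) hκ (by omega) (by omega)
    (by omega) (by omega) (by rw [hpow]; exact hpos)
    (by rw [hpow, hpow]; exact (mul_le_mul_of_nonneg_right hb₁ hQ0).trans hmom')
    (by rw [hpow, hpow]; exact (mul_le_mul_of_nonneg_right hb₂ hQ0).trans hmom')
  obtain ⟨hsplit, hlaw⟩ := CrossMMD.map_split_eq (hX n) (hY n) (h_indep n)
  have hchar : charFun ((Pr n).map fun ω =>
      (k n).studentizedCrossMMD (fun i => X n i ω) (fun j => Y n j ω)) t =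
      ∫ p : (Fin (n - n / 2) ⊕ Fin (m n - m n / 2) → 𝒳) × (Fin (n / 2) ⊕ Fin (m n / 2) → 𝒳),
        Complex.exp ((t * CrossMMD.crossStatistic κ p.1 p.2 : ℝ) * Complex.I)
        ∂((Measure.pi fun _ => P).prod (Measure.pi fun _ => P)) := by
    rw [charFun_apply_real, integral_map (hae n) (by fun_prop), ← hlaw, integral_map hsplit]
    · have hcongr := CrossMMD.crossStatistic_ae_eq hG hκG (n / 2) (m n / 2) (n - n / 2)
        (m n - m n / 2)
      rw [← hlaw] at hcongr
      refine integral_congr_ae ?_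
      filter_upwards [ae_of_ae_map hsplit hcongr] with ω hω
      rw [hω, CrossMMD.studentizedCrossMMD_eq (k n) hn hmn (μ n)]
      push_cast
      rfl
    · have := hκ.measurable_crossStatistic (n / 2) (m n / 2) (n - n / 2) (m n - m n / 2)
      exact Measurable.aestronglyMeasurable (by fun_prop)
  rw [hchar, dist_eq_norm]
  exact hfinal.trans_lt (half_lt_self hε)
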